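/- Let $k\ge 1$, let $a,e\in\mathbb R$ be such that $P(x,y)=xy^2+ay-e$ is irreducible (i.e. $e\neq 0$), and let $C=\{(x,y)\in\mathbb R^2: P(x,y)=0\}$. Let $I\subseteq\mathbb R[x,y]$ be the ideal of polynomials vanishing on $C$, $\mathbb R[C]=\mathbb R[x,y]/I$, $I_{\le m}=I\cap\mathbb R[x,y]_{\le m}$, where $\mathbb R[x,y]_{\le m}$ denotes the polynomials of total degree at most $m$, and let $\mathbb R[C]_{\le m}$ be the image of $\mathbb R[x,y]_{\le m}$ in $\mathbb R[C]$. In $\mathbb R[C]$ put $$\mathcal B_k=\{x^k,\,x^{k-1},x^{k-1}y,\ldots,x,xy,\,1,y,\ldots,y^k\},\qquad \widetilde{\mathcal B}_k=(\mathcal B_k\setminus\{x^k\})\cup\{x^ky\},$$ $$V^{(k)}=\operatorname{Lin}\widetilde{\mathcal B}_k,\quad U=\operatorname{Lin}(\mathcal B_k\setminus\{x^k\}),\quad W=\operatorname{Lin}(\mathcal B_k\setminus\{y^k\}),\quad Z=\operatorname{Lin}(\widetilde{\mathcal B}_k\setminus\{y^k\}).$$ Let $L:\mathbb R[x,y]_{\le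 2k}\to\mathbb R$ be a linear functional that vanishes on $I_{\le 2k}$, let $L_C:\mathbb R[C]_{\le 2k}\to\mathbb R$, $L_C(f+I)=L(f)$, be the induced functional, and consider the bilinear forms $$\overline L(f,g)=L(fg)\ \text{ on }\mathbb R[x,y]_{\le k},\qquad \overline L_C(f,g)=L_C(fg)\ \text{ on }\mathbb R[C]_{\le k},\qquad \overline L_{C,V^{(k)},1}(g,h)=L_C(gh)\ \text{ on }V^{(k)}$$ (products of elements of $V^{(k)}$ lie in $\mathbb R[C]_{\le 2k}$). Assume that $L$ is $C$-singular, i.e. that $\ker\overline L\neq I_{\le k}$ or $\ker\overline L_{C,V^{(k)},1}\neq\{0\}$. Then the following are equivalent: 1. $L$ is a $C$-moment functional: there is a positive Borel measure $\mu$ on $\mathbb R^2$ supported on $C$ such that $L(f)=\int_C f\,d\mu$ for every $f\in\mathbb R[x,y]_{\le 2k}$ (all these integrals being finite). 2. $L_C(g^2)\ge 0$ for every $0\ne g\in\mathbb R[C]_{\le k}$ (square positivity), $L_C(g^2)\ge 0$ for every $0\ne g\in V^{(k)}$ ($(V^{(k)},1)$-local square positivity), $$\operatorname{rank}\overline L_C=\operatorname{rank}\big(\overline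 L_C|_U\big),$$ and at least one of the following holds: (a) $\operatorname{rank}\overline L_C=\operatorname{rank}\big(\overline L_C|_W\big)$; (b) $\operatorname{rank}\overline L_{C,V^{(k)},1}=\operatorname{rank}\big(\overline L_{C,V^{(k)},1}|_Z\big)$. -/

import Mathlib

namespace CubicTMP

open MvPolynomial

noncomputable section

/-- Real polynomials in two variables; `X 0` is `x` and `X 1` is `y`. -/
abbrev Poly : Type := MvPolynomial (Fin 2) ℝ

/-- `ℝ[x,y]_{≤ m}`: polynomials of total degree at most `m`. -/
abbrev PolyLE (m : ℕ) : Submodule ℝ Poly := restrictTotalDegree (Fin 2) ℝ m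

/-- The real zero set `𝒵(P)` of a polynomial in the plane. -/
def zeroSet (P : Poly) : Set (Fin 2 → ℝ) := {z | eval z P = 0}

/-- The coordinate ring `ℝ[C] = ℝ[x,y] / I`, with `I` the ideal of all polynomials vanishing
on `C`. -/
def CoordRing (C : Set (Fin 2 → ℝ)) : Type := Poly ⧸ vanishingIdeal ℝ C

instance (C : Set (Fin 2 → ℝ)) : CommRing (CoordRing C) :=
  inferInstanceAs (CommRing (Poly ⧸ vanishingIdeal ℝ C))

instance (C : Set (Fin 2 → ℝ)) : Algebra ℝ (CoordRing C) :=
  inferInstanceAs (Algebra ℝ (Poly ⧸ vanishingIdeal ℝ C))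

/-- The restriction map `ℝ[x,y] → ℝ[C]`. -/
def toCoord (C : Set (Fin 2 → ℝ)) : Poly →ₐ[ℝ] CoordRing C :=
  Ideal.Quotient.mkₐ ℝ (vanishingIdeal ℝ C)

theorem toCoord_eq_zero_iff {C : Set (Fin 2 → ℝ)} {p : Poly} :
    toCoord C p = 0 ↔ p ∈ vanishingIdeal ℝ C :=
  Ideal.Quotient.eq_zero_iff_mem

/-- `ℝ[C]_{≤ m}`: the image of `ℝ[x,y]_{≤ m}` in `ℝ[C]`. -/
def CoordLE (C : Set (Fin 2 → ℝ)) (m : ℕ) : Submodule ℝ (CoordRing C) :=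
  (PolyLE m).map (toCoord C).toLinearMap

/-- `I_{≤ m} = I ∩ ℝ[x,y]_{≤ m}`, as a subspace of `ℝ[x,y]_{≤ m}`. -/
def idealLE (C : Set (Fin 2 → ℝ)) (m : ℕ) : Submodule ℝ (PolyLE m) :=
  ((vanishingIdeal ℝ C).restrictScalars ℝ).submoduleOf (PolyLE m)

/-- The restriction map `ℝ[x,y]_{≤ m} → ℝ[C]_{≤ m}`. -/
def toCoordLE (C : Set (Fin 2 → ℝ)) (m : ℕ) : PolyLE m →ₗ[ℝ] CoordLE C m :=
  (toCoord C).toLinearMap.submoduleMap (PolyLE m)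

theorem toCoordLE_surjective (C : Set (Fin 2 → ℝ)) (m : ℕ) :
    Function.Surjective (toCoordLE C m) :=
  LinearMap.submoduleMap_surjective _ _

theorem ker_toCoordLE (C : Set (Fin 2 → ℝ)) (m : ℕ) :
    LinearMap.ker (toCoordLE C m) = idealLE C m := by
  ext p
  rw [LinearMap.mem_ker, ← Subtype.coe_inj]
  exact toCoord_eq_zero_iff

/-- `L` vanishes on `I_{≤ m}`, i.e. the induced functional `L_C` is well defined. -/
def Descends (C : Set (Fin 2 → ℝ)) {m : ℕ} (L : PolyLE m →ₗ[ℝ] ℝ) : Prop :=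
  ∀ p ∈ idealLE C m, L p = 0

/-- The functional `L_C : ℝ[C]_{≤ m} → ℝ`, `L_C (p + I) = L p`. -/
def inducedFunctional (C : Set (Fin 2 → ℝ)) {m : ℕ} (L : PolyLE m →ₗ[ℝ] ℝ)
    (hL : Descends C L) : CoordLE C m →ₗ[ℝ] ℝ :=
  ((LinearMap.ker (toCoordLE C m)).liftQ L
      (fun p hp => hL p (by rwa [ker_toCoordLE] at hp))).comp
    ((toCoordLE C m).quotKerEquivOfSurjective (toCoordLE_surjective C m)).symm.toLinearMap

theorem inducedFunctional_apply (C : Set (Fin 2 → ℝ)) {m : ℕ} (L : PolyLE m →ₗ[ℝ] ℝ)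
    (hL : Descends C L) (p : PolyLE m) :
    inducedFunctional C L hL (toCoordLE C m p) = L p := by
  have h : ((toCoordLE C m).quotKerEquivOfSurjective (toCoordLE_surjective C m)).symm
      (toCoordLE C m p) = Submodule.Quotient.mk p := by
    rw [LinearEquiv.symm_apply_eq]
    rfl
  rw [inducedFunctional, LinearMap.comp_apply, LinearEquiv.coe_coe, h]
  exact Submodule.liftQ_apply _ _ _

theorem mul_mem_polyLE {k : ℕ} {p q : Poly} (hp : p ∈ PolyLE k) (hq : q ∈ PolyLE k) :
    p * q ∈ PolyLE (2 * k) := by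
  rw [mem_restrictTotalDegree] at *
  exact (totalDegree_mul p q).trans (by omega)

theorem mul_mem_coordLE {C : Set (Fin 2 → ℝ)} {k : ℕ} {g h : CoordRing C}
    (hg : g ∈ CoordLE C k) (hh : h ∈ CoordLE C k) : g * h ∈ CoordLE C (2 * k) := by
  obtain ⟨p, hp, rfl⟩ := hg
  obtain ⟨q, hq, rfl⟩ := hh
  exact ⟨p * q, mul_mem_polyLE hp hq, map_mul (toCoord C) p q⟩

/-- The bilinear form `L̄ (p, q) = L (p q)` on `ℝ[x,y]_{≤ k}`. -/
def polyForm {k : ℕ} (L : PolyLE (2 * k) →ₗ[ℝ] ℝ) : LinearMap.BilinForm ℝ (PolyLE k) :=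
  LinearMap.mk₂ ℝ (fun p q => L ⟨p.1 * q.1, mul_mem_polyLE p.2 q.2⟩)
    (fun p p' q => by rw [← map_add]; congr 1; ext1; simp [add_mul])
    (fun c p q => by rw [← map_smul]; congr 1; ext1; simp)
    (fun p q q' => by rw [← map_add]; congr 1; ext1; simp [mul_add])
    (fun c p q => by rw [← map_smul]; congr 1; ext1; simp)

/-- The localized bilinear form `(g, h) ↦ ℓ (f g h)` on a subspace `V` of `ℝ[C]` such that
`f g h ∈ ℝ[C]_{≤ m}` for all `g, h ∈ V`. -/
def localForm {C : Set (Fin 2 → ℝ)} {m : ℕ} (ℓ : CoordLE C m →ₗ[ℝ] ℝ)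
    (V : Submodule ℝ (CoordRing C)) (f : CoordRing C)
    (hV : ∀ g ∈ V, ∀ h ∈ V, f * (g * h) ∈ CoordLE C m) : LinearMap.BilinForm ℝ V :=
  LinearMap.mk₂ ℝ (fun g h => ℓ ⟨f * (g.1 * h.1), hV g.1 g.2 h.1 h.2⟩)
    (fun p p' q => by rw [← map_add]; congr 1; ext1; simp [add_mul, mul_add])
    (fun c p q => by rw [← map_smul]; congr 1; ext1; simp)
    (fun p q q' => by rw [← map_add]; congr 1; ext1; simp [mul_add])
    (fun c p q => by rw [← map_smul]; congr 1; ext1; simp)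

/-- The bilinear form `(g, h) ↦ ℓ (g h)` on `ℝ[C]_{≤ k}`. -/
def coordForm {C : Set (Fin 2 → ℝ)} {k : ℕ} (ℓ : CoordLE C (2 * k) →ₗ[ℝ] ℝ) :
    LinearMap.BilinForm ℝ (CoordLE C k) :=
  LinearMap.mk₂ ℝ (fun g h => ℓ ⟨g.1 * h.1, mul_mem_coordLE g.2 h.2⟩)
    (fun p p' q => by rw [← map_add]; congr 1; ext1; simp [add_mul])
    (fun c p q => by rw [← map_smul]; congr 1; ext1; simp)
    (fun p q q' => by rw [← map_add]; congr 1; ext1; simp [mul_add])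
    (fun c p q => by rw [← map_smul]; congr 1; ext1; simp)

/-- `ker B = {v | B (u, v) = 0 for every u}`. -/
def formKer {V : Type} [AddCommGroup V] [Module ℝ V] (B : LinearMap.BilinForm ℝ V) :
    Submodule ℝ V :=
  LinearMap.ker (LinearMap.flip B)

/-- The rank of a bilinear form (the rank of its matrix in any basis), as the rank of the linear
map `V → V*`, `u ↦ B (u, ·)`. -/
def formRank {V : Type} [AddCommMonoid V] [Module ℝ V] (B : LinearMap.BilinForm ℝ V) : Cardinal :=
  LinearMap.rank B

/-- The restriction of a bilinear form on a subspace `V` to a subspace `U ⊆ V`. -/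
def restrictForm {M : Type} [AddCommGroup M] [Module ℝ M] {V : Submodule ℝ M}
    (B : LinearMap.BilinForm ℝ V) (U : Submodule ℝ M) :
    LinearMap.BilinForm ℝ (U.submoduleOf V) :=
  LinearMap.BilinForm.restrict B (U.submoduleOf V)

/-- A bilinear form is nonnegative on the diagonal: `B (g, g) ≥ 0` for all `g ≠ 0`. Applied to
`coordForm` this is square positivity, applied to `localForm` local square positivity. -/
def SquarePositive {V : Type} [AddCommGroup V] [Module ℝ V] (B : LinearMap.BilinForm ℝ V) : Prop :=
  ∀ g : V, g ≠ 0 → 0 ≤ B g g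

/-- `L` is a `C`-moment functional: it is integration against a (positive) Borel measure on the
plane that is supported on `C`. -/
def IsMomentFunctional (C : Set (Fin 2 → ℝ)) {m : ℕ} (L : PolyLE m →ₗ[ℝ] ℝ) : Prop :=
  ∃ μ : MeasureTheory.Measure (Fin 2 → ℝ), μ Cᶜ = 0 ∧
    ∀ p : PolyLE m, MeasureTheory.IntegrableOn (fun z => eval z p.1) C μ ∧
      L p = ∫ z in C, eval z p.1 ∂μ

/-- The cubic `x y² + a y - d x - e`. -/
def P6 (a d e : ℝ) : Poly := X 0 * X 1 ^ 2 + C a * X 1 - C d * X 0 - C e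

section Curve

variable (a d e : ℝ)

/-- The real curve `x y² + a y - d x - e = 0`. -/
def curve6 : Set (Fin 2 → ℝ) := zeroSet (P6 a d e)

/-- The coordinate function `x` in `ℝ[C]`. -/
def xC : CoordRing (curve6 a d e) := toCoord (curve6 a d e) (X 0)

/-- The coordinate function `y` in `ℝ[C]`. -/
def yC : CoordRing (curve6 a d e) := toCoord (curve6 a d e) (X 1)

/-- `𝓑_k = {x^k, x^(k-1), x^(k-1) y, …, x, x y, 1, y, …, y^k}`. -/
def basisB (k : ℕ) : Set (CoordRing (curve6 a d e)) :=
  {g | g = xC a d e ^ k ∨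
    (∃ i : ℕ, 1 ≤ i ∧ i < k ∧ (g = xC a d e ^ i ∨ g = xC a d e ^ i * yC a d e)) ∨
    ∃ j : ℕ, j ≤ k ∧ g = yC a d e ^ j}

/-- `𝓑̃_k = (𝓑_k ∖ {x^k}) ∪ {x^k y}`. -/
def basisBtilde (k : ℕ) : Set (CoordRing (curve6 a d e)) :=
  (basisB a d e k \ {xC a d e ^ k}) ∪ {xC a d e ^ k * yC a d e}

/-- `V^(k) = span 𝓑̃_k`. -/
def spaceV (k : ℕ) : Submodule ℝ (CoordRing (curve6 a d e)) :=
  Submodule.span ℝ (basisBtilde a d e k)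

/-- `U = span (𝓑_k ∖ {x^k})`. -/
def spaceU (k : ℕ) : Submodule ℝ (CoordRing (curve6 a d e)) :=
  Submodule.span ℝ (basisB a d e k \ {xC a d e ^ k})

/-- `W = span (𝓑_k ∖ {y^k})`. -/
def spaceW (k : ℕ) : Submodule ℝ (CoordRing (curve6 a d e)) :=
  Submodule.span ℝ (basisB a d e k \ {yC a d e ^ k})

/-- `Z = span (𝓑̃_k ∖ {y^k})`. -/
def spaceZ (k : ℕ) : Submodule ℝ (CoordRing (curve6 a d e)) :=
  Submodule.span ℝ (basisBtilde a d e k \ {yC a d e ^ k})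

theorem monomial_mem_coordLE {i j m : ℕ} (h : i + j ≤ m) :
    xC a d e ^ i * yC a d e ^ j ∈ CoordLE (curve6 a d e) m := by
  refine ⟨X 0 ^ i * X 1 ^ j, ?_, ?_⟩
  · refine (mem_restrictTotalDegree _ _ _).2 ((totalDegree_mul _ _).trans ?_)
    rw [totalDegree_X_pow, totalDegree_X_pow]
    exact h
  · exact (map_mul (toCoord (curve6 a d e)) _ _).trans (by rw [map_pow, map_pow]; rfl)

theorem curve6_relation :
    xC a d e * yC a d e ^ 2 = d • xC a d e + e • 1 - a • yC a d e := by
  have h : toCoord (curve6 a d e) (P6 a d e) = 0 := by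
    refine toCoord_eq_zero_iff.2 ?_
    intro z hz
    exact hz
  have h2 : toCoord (curve6 a d e) (P6 a d e) =
      xC a d e * yC a d e ^ 2 + a • yC a d e - d • xC a d e - e • 1 := by
    simp only [P6, map_sub, map_add, map_mul, map_pow, ← algebraMap_eq, AlgHom.commutes,
      Algebra.smul_def, mul_one]
    rfl
  rw [h] at h2
  rw [eq_comm, ← sub_eq_zero] at h2
  rw [← sub_eq_zero, ← h2]
  abel

theorem basisB_subset (k : ℕ) :
    basisB a d e k ⊆ CoordLE (curve6 a d e) k := by
  rintro g (rfl | ⟨i, hi, hik, rfl | rfl⟩ | ⟨j, hj, rfl⟩)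
  · simpa using monomial_mem_coordLE a d e (i := k) (j := 0) le_rfl
  · simpa using monomial_mem_coordLE a d e (i := i) (j := 0) hik.le
  · simpa using monomial_mem_coordLE a d e (i := i) (j := 1) (by omega)
  · simpa using monomial_mem_coordLE a d e (i := 0) (j := j) (by omega)

theorem spaceU_le (k : ℕ) : spaceU a d e k ≤ CoordLE (curve6 a d e) k :=
  Submodule.span_le.2 (Set.diff_subset.trans (basisB_subset a d e k))

theorem spaceW_le (k : ℕ) : spaceW a d e k ≤ CoordLE (curve6 a d e) k :=
  Submodule.span_le.2 (Set.diff_subset.trans (basisB_subset a d e k))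

theorem spaceZ_le (k : ℕ) : spaceZ a d e k ≤ spaceV a d e k :=
  Submodule.span_mono Set.diff_subset

/-- All products of two elements of `V^(k)` lie in `ℝ[C]_{≤ 2k}`. -/
theorem spaceV_mul_mem {k : ℕ} (hk : 1 ≤ k) :
    ∀ g ∈ spaceV a d e k, ∀ h ∈ spaceV a d e k,
      (1 : CoordRing (curve6 a d e)) * (g * h) ∈ CoordLE (curve6 a d e) (2 * k) := by
  have hm : ∀ i j : ℕ, i + j ≤ 2 * k →
      xC a d e ^ i * yC a d e ^ j ∈ CoordLE (curve6 a d e) (2 * k) :=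
    fun i j h => monomial_mem_coordLE a d e h
  have hr : ∀ i j : ℕ, 1 ≤ i → i + j ≤ 2 * k →
      xC a d e ^ i * yC a d e ^ (j + 2) ∈ CoordLE (curve6 a d e) (2 * k) := by
    intro i j hi hij
    obtain ⟨i, rfl⟩ : ∃ i', i = i' + 1 := ⟨i - 1, by omega⟩
    have : xC a d e ^ (i + 1) * yC a d e ^ (j + 2) =
        d • (xC a d e ^ (i + 1) * yC a d e ^ j) + e • (xC a d e ^ i * yC a d e ^ j)
          - a • (xC a d e ^ i * yC a d e ^ (j + 1)) := by
      calc xC a d e ^ (i + 1) * yC a d e ^ (j + 2)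
          = (xC a d e ^ i * yC a d e ^ j) * (xC a d e * yC a d e ^ 2) := by ring
        _ = _ := by
          rw [curve6_relation]
          simp only [Algebra.smul_def]
          ring
    rw [this]
    exact Submodule.sub_mem _ (Submodule.add_mem _ (Submodule.smul_mem _ _ (hm _ _ (by omega)))
      (Submodule.smul_mem _ _ (hm _ _ (by omega)))) (Submodule.smul_mem _ _ (hm _ _ (by omega)))
  have hx : ∀ h ∈ basisBtilde a d e k,
      xC a d e ^ k * yC a d e * h ∈ CoordLE (curve6 a d e) (2 * k) := by
    rintro h (⟨rfl | ⟨i, hi, hik, rfl | rfl⟩ | ⟨j, hj, rfl⟩, hne⟩ | rfl)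
    · exact absurd rfl hne
    · convert hm (k + i) 1 (by omega) using 1; ring
    · convert hr (k + i) 0 (by omega) (by omega) using 1; ring
    · rcases j with _ | j
      · convert hm k 1 (by omega) using 1; ring
      · rcases j with _ | j
        · convert hr k 0 (by omega) (by omega) using 1; ring
        · convert hr k (j + 1) (by omega) (by omega) using 1; ring
    · convert hr (k + k) 0 (by omega) (by omega) using 1; ring
  have hb : ∀ g ∈ basisBtilde a d e k, ∀ h ∈ basisBtilde a d e k,
      g * h ∈ CoordLE (curve6 a d e) (2 * k) := by
    rintro g hg h hh
    rcases hg with hg' | rfl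
    · rcases hh with hh' | rfl
      · exact mul_mem_coordLE (basisB_subset a d e k hg'.1) (basisB_subset a d e k hh'.1)
      · rw [mul_comm g]
        exact hx g (Or.inl hg')
    · exact hx h hh
  intro g hg h hh
  rw [one_mul]
  have := Submodule.mul_mem_mul hg hh
  rw [spaceV, Submodule.span_mul_span] at this
  refine Submodule.span_le.2 ?_ this
  rintro _ ⟨g, hg, h, hh, rfl⟩
  exact hb g hg h hh

end Curve

/-- The `(V^(k), 1)`-localized form of the curve `x y² + a y - d x - e = 0`. -/
def curveLocalForm (a d e : ℝ) {k : ℕ} (hk : 1 ≤ k)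
    (ℓ : CoordLE (curve6 a d e) (2 * k) →ₗ[ℝ] ℝ) : LinearMap.BilinForm ℝ (spaceV a d e k) :=
  localForm ℓ (spaceV a d e k) 1 (spaceV_mul_mem a d e hk)

/-- Nonsingularity of `L` with respect to the curve `C : x y² + a y - d x - e = 0`, for
functionals vanishing on `I_{≤ 2k}`: `ker L̄ = I_{≤ k}`, and the `(V^(k), 1)`-localized form
of `L_C` has trivial kernel. -/
def IsNonsingular (a d e : ℝ) {k : ℕ} (hk : 1 ≤ k) (L : PolyLE (2 * k) →ₗ[ℝ] ℝ)
    (hL : Descends (curve6 a d e) L) : Prop :=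
  formKer (polyForm L) = idealLE (curve6 a d e) k ∧
    formKer (curveLocalForm a d e hk (inducedFunctional (curve6 a d e) L hL)) = ⊥

end

end CubicTMP

/-! The equation reads y(xy + a) = e with e ≠ 0, so y is invertible on C, x = e y⁻² − a y⁻¹, and
ℝ[C] consists of Laurent polynomials in y. Multiplication by y^(2k) turns V^(k) into the polynomials
XF with deg F ≤ 3k − 1, U into the X²F with deg F ≤ 3k − 2, and ℝ[C]_{≤ k} into the F of degree ≤ 3k
with e F₁ + k a F₀ = 0. The problem is thus a truncated Hamburger problem of degree 6k with one
moment missing, and with no atom allowed at 0.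

Call q isotropic if L_C(q²) = 0. For sufficiency, the rank condition on U yields an isotropic P with
P(0) ≠ 0, and (a) or (b) yields an isotropic monic Q of degree 3k. The missing moment is fixed by
giving XP the value 0. Then P is orthogonal to all Xg with deg g ≤ 3k − 1; since every polynomial of
degree ≤ 3k is cP + Xg, positivity on V^(k) gives positivity in full. By Q the Hamburger functional
is singular, hence atomic; P vanishes at the atoms, so none is 0 and all lift to C
(`exists_atomic_on_curve`).

For necessity, an isotropic element of a measure vanishes almost everywhere, so its multiples are
isotropic as long as their squares stay in ℝ[C]_{≤ 2k}. Singularity provides a nonzero isotropic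
element, and multiplication adjusts its order at 0 and its degree
(`IsMomentFunctional.exists_isotropic`). The spaces U, W, Z have codimension at most 1, so an
isotropic vector outside one of them gives equality of ranks. -/

namespace CubicTMP

/-! ### Singular Hamburger moment problem on the line -/

section Hamburger

open Polynomial

/-- A positive functional satisfies the degenerate case of the Cauchy–Schwarz inequality. -/
theorem apply_mul_eq_zero_of_isotropic {A : Type*} [CommRing A] [Algebra ℝ A] (M : A →ₗ[ℝ] ℝ)
    (S : Submodule ℝ A) (hM : ∀ f ∈ S, 0 ≤ M (f * f)) {q h : A} (hq : q ∈ S) (hh : h ∈ S)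
    (hq0 : M (q * q) = 0) : M (q * h) = 0 := by
  have key : ∀ c : ℝ, 0 ≤ M (h * h) + 2 * c * M (q * h) := by
    intro c
    have h1 := hM (h + c • q) (S.add_mem hh (S.smul_mem c hq))
    have h2 : (h + c • q) * (h + c • q) = h * h + (2 * c) • (q * h) + (c * c) • (q * q) := by
      simp only [Algebra.smul_def, map_mul, map_ofNat]
      ring
    rw [h2, map_add, map_add, map_smul, map_smul, hq0] at h1
    simpa using h1
  by_contra hne
  -- This value of c makes the right side of `key` equal to −1.
  have h3 := key (-(M (h * h) + 1) / (2 * M (q * h)))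
  have h4 : 2 * (-(M (h * h) + 1) / (2 * M (q * h))) * M (q * h) = -(M (h * h) + 1) := by
    field_simp
  linarith

variable {Λ : ℝ[X] →ₗ[ℝ] ℝ}

theorem apply_mul_eq_zero_of_apply_sq_eq_zero (hΛ : ∀ f, 0 ≤ Λ (f * f)) {f : ℝ[X]}
    (hf : Λ (f * f) = 0) (h : ℝ[X]) : Λ (f * h) = 0 :=
  apply_mul_eq_zero_of_isotropic Λ ⊤ (fun f _ => hΛ f) trivial trivial hf

/-- The radical of a positive functional is stable under removing multiplicities and nonreal
roots from a factor. -/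
theorem exists_prod_mul_mem_radical (hΛ : ∀ f, 0 ≤ Λ (f * f)) (n : ℕ) :
    ∀ f : ℝ[X], f.natDegree = n → f ≠ 0 → ∀ h : ℝ[X], (∀ g, Λ (f * h * g) = 0) →
      ∃ S : Finset ℝ, ∀ g, Λ ((∏ s ∈ S, (X - C s)) * h * g) = 0 := by
  induction n using Nat.strong_induction_on with
  | _ n ih =>
    intro f hfn hf0 h hfh
    rcases Nat.eq_zero_or_pos n with rfl | hn
    · refine ⟨∅, fun g => ?_⟩
      obtain ⟨c, rfl⟩ := natDegree_eq_zero.1 hfn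
      have hc : c ≠ 0 := by rintro rfl; simp at hf0
      have := hfh (C c⁻¹ * g)
      rw [show C c * h * (C c⁻¹ * g) = C (c * c⁻¹) * (h * g) by rw [C_mul]; ring,
        mul_inv_cancel₀ hc, C_1, one_mul] at this
      simpa using this
    · obtain ⟨z, hz⟩ := Complex.exists_root (f := f.map (algebraMap ℝ ℂ))
        (by rw [degree_map]; exact natDegree_pos_iff_degree_pos.1 (hfn ▸ hn))
      have hz' : aeval z f = 0 := by rwa [IsRoot, eval_map_algebraMap] at hz
      by_cases him : z.im = 0
      · have hr : f.IsRoot z.re := by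
          have h1 : z = algebraMap ℝ ℂ z.re := Complex.ext rfl (by simpa using him)
          rw [h1, aeval_algebraMap_apply] at hz'
          simpa using hz'
        obtain ⟨v, rfl⟩ := dvd_iff_isRoot.2 hr
        set r := z.re
        have hv0 : v ≠ 0 := right_ne_zero_of_mul hf0
        have hdeg : v.natDegree < n := by
          rw [← hfn, natDegree_mul (X_sub_C_ne_zero r) hv0, natDegree_X_sub_C]
          omega
        -- The real linear factor is stored in h during the induction. If r is already in S, it
        -- occurs twice, and positivity removes the repetition.
        obtain ⟨S, hS⟩ := ih _ hdeg v rfl hv0 ((X - C r) * h)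
          (fun g => by rw [← hfh g]; congr 1; ring)
        by_cases hrS : r ∈ S
        · refine ⟨S, fun g => apply_mul_eq_zero_of_apply_sq_eq_zero hΛ ?_ g⟩
          rw [← hS ((∏ s ∈ S.erase r, (X - C s)) * h), ← Finset.mul_prod_erase S _ hrS]
          congr 1
          ring
        · refine ⟨insert r S, fun g => ?_⟩
          rw [Finset.prod_insert hrS, ← hS g]
          congr 1
          ring
      · obtain ⟨v, rfl⟩ := quadratic_dvd_of_aeval_eq_zero_im_ne_zero f hz' him
        have hv0 : v ≠ 0 := right_ne_zero_of_mul hf0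
        have hq0 := left_ne_zero_of_mul hf0
        have hq : (X ^ 2 - C (2 * z.re) * X + C (‖z‖ ^ 2) : ℝ[X]).natDegree = 2 := by
          compute_degree!
        have hdeg : v.natDegree < n := by
          rw [← hfn, natDegree_mul hq0 hv0, hq]
          omega
        refine ih _ hdeg v rfl hv0 h
          (fun g => apply_mul_eq_zero_of_apply_sq_eq_zero hΛ (le_antisymm ?_ (hΛ _)) g)
        -- The quadratic factor is (X − re z)² + (im z)², so testing against vh gives a sum of two
        -- nonnegative terms equal to 0; hence vh is isotropic and the factor can be dropped.
        have h1 := hfh (v * h)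
        have h2 : (X ^ 2 - C (2 * z.re) * X + C (‖z‖ ^ 2)) * v * h * (v * h) =
            ((X - C z.re) * (v * h)) * ((X - C z.re) * (v * h)) +
              (z.im ^ 2) • ((v * h) * (v * h)) := by
          rw [smul_eq_C_mul, Complex.sq_norm, Complex.normSq_apply]
          simp only [C_mul, C_add, C_pow, map_ofNat]
          ring
        rw [h2, map_add, map_smul, smul_eq_mul] at h1
        have h3 := hΛ ((X - C z.re) * (v * h))
        have h4 : 0 < z.im ^ 2 := by positivity
        nlinarith

/-- A positive functional on `ℝ[X]` that annihilates a nonzero ideal is a finite positive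
combination of point evaluations. -/
theorem exists_atomic_of_annihilates (hΛ : ∀ f, 0 ≤ Λ (f * f)) {Q : ℝ[X]} (hQ : Q ≠ 0)
    (hQΛ : ∀ g, Λ (Q * g) = 0) :
    ∃ (S : Finset ℝ) (w : ℝ → ℝ), (∀ s ∈ S, 0 ≤ w s) ∧
      ∀ f, Λ f = ∑ s ∈ S, w s * f.eval s := by
  obtain ⟨S, hS⟩ := exists_prod_mul_mem_radical hΛ _ Q rfl hQ 1 (by simpa using hQΛ)
  have hzero : ∀ f : ℝ[X], (∀ s ∈ S, f.eval s = 0) → Λ f = 0 := by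
    intro f hf
    obtain ⟨g, rfl⟩ : (∏ s ∈ S, (X - C s)) ∣ f :=
      Finset.prod_dvd_of_coprime
        (fun i _ j _ hij => pairwise_coprime_X_sub_C Function.injective_id hij)
        (fun s hs => dvd_iff_isRoot.2 (hf s hs))
    simpa using hS g
  have hbasis : ∀ s ∈ S, ∀ s' ∈ S, (Lagrange.basis S id s).eval s' = if s = s' then 1 else 0 := by
    intro s hs s' hs'
    split_ifs with h
    · subst h
      exact Lagrange.eval_basis_self Function.injective_id.injOn hs
    · exact Lagrange.eval_basis_of_ne (v := id) h hs'
  have hrep : ∀ f, Λ f = ∑ s ∈ S, Λ (Lagrange.basis S id s) * f.eval s := by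
    intro f
    have := hzero (f - ∑ s ∈ S, f.eval s • Lagrange.basis S id s) (by
      intro s hs
      rw [eval_sub, eval_finsetSum, Finset.sum_eq_single_of_mem s hs, eval_smul, hbasis s hs s hs]
      · simp
      · intro b hb hbs
        rw [eval_smul, hbasis b hb s hs, if_neg hbs, smul_zero])
    rw [map_sub, map_sum, sub_eq_zero] at this
    rw [this]
    exact Finset.sum_congr rfl fun s _ => by rw [map_smul, smul_eq_mul, mul_comm]
  -- The square of a Lagrange basis polynomial has the same values on S as the polynomial itself, so
  -- the weight is Λ of a square.
  refine ⟨S, fun s => Λ (Lagrange.basis S id s), fun s hs => ?_, hrep⟩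
  have h1 := hΛ (Lagrange.basis S id s)
  rw [hrep, Finset.sum_eq_single_of_mem s hs] at h1
  · simpa [hbasis s hs s hs] using h1
  · intro b hb hbs
    rw [eval_mul, hbasis s hs b hb, if_neg hbs.symm]
    simp

/-- Truncated Hamburger problem, singular case: a functional that is positive on squares of
degree `≤ 2 n` and has an isotropic element of degree exactly `n` is atomic; every other isotropic
element vanishes at the atoms. -/
theorem exists_atomic_of_isotropic_monic {n : ℕ} (M : ℝ[X] →ₗ[ℝ] ℝ)
    (hM : ∀ f : ℝ[X], f.natDegree ≤ n → 0 ≤ M (f * f))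
    {Q : ℝ[X]} (hQ : Q.Monic) (hQn : Q.natDegree = n) (hQ0 : M (Q * Q) = 0) :
    ∃ (S : Finset ℝ) (w : ℝ → ℝ), (∀ s ∈ S, 0 ≤ w s) ∧
      (∀ f : ℝ[X], f.natDegree ≤ 2 * n → M f = ∑ s ∈ S, w s * f.eval s) ∧
      ∀ P : ℝ[X], P.natDegree ≤ n → M (P * P) = 0 → ∀ s ∈ S, P.eval s = 0 := by
  have hQM : ∀ h : ℝ[X], h.natDegree ≤ n → M (Q * h) = 0 := fun h hh =>
    apply_mul_eq_zero_of_isotropic M (degreeLE ℝ n)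
      (fun f hf => hM f (natDegree_le_iff_degree_le.2 (mem_degreeLE.1 hf)))
      (mem_degreeLE.2 (natDegree_le_iff_degree_le.1 hQn.le))
      (mem_degreeLE.2 (natDegree_le_iff_degree_le.1 hh)) hQ0
  have hrem : ∀ f : ℝ[X], (f %ₘ Q).natDegree ≤ n := fun f => by
    rw [← hQn]; exact natDegree_modByMonic_le f hQ
  have hdiv : ∀ f : ℝ[X], f.natDegree ≤ 2 * n → M (f %ₘ Q) = M f := by
    intro f hf
    conv_rhs => rw [← modByMonic_add_div f Q, map_add]
    rw [hQM (f /ₘ Q) (by rw [natDegree_divByMonic f hQ]; omega), add_zero]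
  -- Λ annihilates the ideal (Q) and agrees with M up to degree 2n, because there the quotient by Q
  -- has degree ≤ n and Q is orthogonal to it.
  let Λ : ℝ[X] →ₗ[ℝ] ℝ := M.comp (modByMonicHom Q)
  have hΛ : ∀ f, Λ f = M (f %ₘ Q) := fun f => rfl
  have hpos : ∀ f, 0 ≤ Λ (f * f) := by
    intro f
    rw [hΛ, mul_modByMonic, hdiv]
    · exact hM _ (hrem f)
    · exact natDegree_mul_le.trans (by have := hrem f; omega)
  have hann : ∀ g, Λ (Q * g) = 0 := by
    intro g
    rw [hΛ, (modByMonic_eq_zero_iff_dvd hQ).2 (dvd_mul_right Q g), map_zero]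
  obtain ⟨S, w, hw, hrep⟩ := exists_atomic_of_annihilates hpos hQ.ne_zero hann
  have hrep' : ∀ f : ℝ[X], f.natDegree ≤ 2 * n →
      M f = ∑ s ∈ S with w s ≠ 0, w s * f.eval s := by
    intro f hf
    rw [← hdiv f hf, ← hΛ, hrep, Finset.sum_filter_of_ne]
    intro s _ h
    exact left_ne_zero_of_mul h
  -- Atoms of weight 0 are discarded, since isotropic polynomials need not vanish there.
  refine ⟨S.filter (w · ≠ 0), w, fun s hs => hw s (Finset.mem_filter.1 hs).1, hrep', ?_⟩
  intro P hP hP0 s hs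
  rw [hrep' _ (natDegree_mul_le.trans (by omega)), Finset.sum_eq_zero_iff_of_nonneg] at hP0
  · have := hP0 s hs
    simpa [(Finset.mem_filter.1 hs).2] using this
  · intro s hs
    rw [eval_mul]
    exact mul_nonneg (hw s (Finset.mem_filter.1 hs).1) (mul_self_nonneg _)

end Hamburger

/-! ### Rank conditions and isotropic vectors -/

section Rank

variable {V : Type} [AddCommGroup V] [Module ℝ V]

theorem mem_ker_of_apply_self_eq_zero {B : LinearMap.BilinForm ℝ V} (hs : B.IsSymm)
    (hB : SquarePositive B) {q : V} (hq : B q q = 0) : q ∈ LinearMap.ker B := by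
  have hpos : ∀ g, 0 ≤ B g g := fun g => by
    rcases eq_or_ne g 0 with rfl | h
    · simp
    · exact hB g h
  rw [LinearMap.mem_ker]
  ext h
  have key : ∀ c : ℝ, 0 ≤ B h h + 2 * c * B q h := by
    intro c
    have h1 := hpos (h + c • q)
    have h2 : B h q = B q h := hs.eq h q
    simp only [map_add, map_smul, LinearMap.add_apply, LinearMap.smul_apply, smul_eq_mul, hq,
      h2] at h1
    linarith
  by_contra hne
  have hne' : B q h ≠ 0 := hne
  have h3 := key (-(B h h + 1) / (2 * B q h))
  have h4 : 2 * (-(B h h + 1) / (2 * B q h)) * B q h = -(B h h + 1) := by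
    field_simp
  linarith

/-- A positive semidefinite form has the same rank as its restriction to `U` iff `U` is a
supplement of its kernel. -/
theorem formRank_eq_formRank_restrict_iff [FiniteDimensional ℝ V] {B : LinearMap.BilinForm ℝ V}
    (hs : B.IsSymm) (hB : SquarePositive B) (U : Submodule ℝ V) :
    formRank B = formRank (LinearMap.BilinForm.restrict B U) ↔ U ⊔ LinearMap.ker B = ⊤ := by
  -- By positivity the kernel of the restriction is just U ∩ ker B; the rest is a dimension count.
  have hker : LinearMap.ker (LinearMap.BilinForm.restrict B U) =
      (LinearMap.ker B).comap U.subtype := by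
    ext u
    constructor
    · intro hu
      refine mem_ker_of_apply_self_eq_zero hs hB ?_
      exact LinearMap.congr_fun (LinearMap.mem_ker.1 hu) u
    · intro hu
      rw [LinearMap.mem_ker]
      ext v
      exact LinearMap.congr_fun (LinearMap.mem_ker.1 (Submodule.mem_comap.1 hu)) v.1
  have h1 := LinearMap.finrank_range_add_finrank_ker B
  have h2 := LinearMap.finrank_range_add_finrank_ker (LinearMap.BilinForm.restrict B U)
  have h3 := Submodule.finrank_sup_add_finrank_inf_eq U (LinearMap.ker B)
  have h4 : Module.finrank ℝ ((LinearMap.ker B).comap U.subtype) =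
      Module.finrank ℝ (U ⊓ LinearMap.ker B : Submodule ℝ V) := by
    rw [← Submodule.map_comap_subtype]
    exact (LinearEquiv.finrank_eq (Submodule.equivMapOfInjective _ U.injective_subtype _))
  rw [hker, h4] at h2
  have h5 : formRank B = formRank (LinearMap.BilinForm.restrict B U) ↔
      Module.finrank ℝ (LinearMap.range B) =
        Module.finrank ℝ (LinearMap.range (LinearMap.BilinForm.restrict B U)) := by
    rw [formRank, formRank, LinearMap.rank, LinearMap.rank, ← Module.finrank_eq_rank,
      ← Module.finrank_eq_rank, Nat.cast_inj]
  rw [h5]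
  constructor
  · intro h
    exact Submodule.eq_top_of_finrank_eq (by omega)
  · intro h
    rw [h, finrank_top] at h3
    omega

/-- Equal ranks mean U + ker B = V, and w is the kernel part of v. With v = x^k or y^k this
prescribes the leading behaviour of an isotropic element. -/
theorem exists_isotropic_of_formRank_eq {M : Type} [AddCommGroup M] [Module ℝ M]
    {V U : Submodule ℝ M} [FiniteDimensional ℝ V] {B : LinearMap.BilinForm ℝ V} (hs : B.IsSymm)
    (hB : SquarePositive B) (hr : formRank B = formRank (restrictForm B U)) (v : V) :
    ∃ w : V, B w w = 0 ∧ (v - w : M) ∈ U := by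
  have h := (formRank_eq_formRank_restrict_iff hs hB _).1 hr
  obtain ⟨u, hu, w, hw, huw⟩ := Submodule.mem_sup.1 (h ▸ Submodule.mem_top : v ∈ _)
  refine ⟨w, by rw [LinearMap.mem_ker.1 hw]; rfl, ?_⟩
  rw [← huw]
  simpa using Submodule.mem_comap.1 hu

/-- As U has codimension at most 1, any kernel vector outside it spans a supplement. -/
theorem formRank_eq_of_isotropic {M : Type} [AddCommGroup M] [Module ℝ M]
    {V U : Submodule ℝ M} [FiniteDimensional ℝ V] {B : LinearMap.BilinForm ℝ V} (hs : B.IsSymm)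
    (hB : SquarePositive B) (hUV : U ≤ V) {v : M} (hV : V ≤ U ⊔ Submodule.span ℝ {v})
    {w : V} (hw : B w w = 0) (hwU : (w : M) ∉ U) :
    formRank B = formRank (restrictForm B U) := by
  refine (formRank_eq_formRank_restrict_iff hs hB _).2 (eq_top_iff.2 fun g _ => ?_)
  obtain ⟨u₁, hu₁, v₁, hv₁, h₁⟩ := Submodule.mem_sup.1 (hV w.2)
  obtain ⟨c₁, rfl⟩ := Submodule.mem_span_singleton.1 hv₁
  obtain ⟨u₂, hu₂, v₂, hv₂, h₂⟩ := Submodule.mem_sup.1 (hV g.2)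
  obtain ⟨c₂, rfl⟩ := Submodule.mem_span_singleton.1 hv₂
  have hc : c₁ ≠ 0 := by
    rintro rfl
    rw [zero_smul, add_zero] at h₁
    exact hwU (h₁ ▸ hu₁)
  have hu : u₂ - (c₂ * c₁⁻¹) • u₁ ∈ U := U.sub_mem hu₂ (U.smul_mem _ hu₁)
  refine Submodule.mem_sup.2 ⟨⟨_, hUV hu⟩, hu, (c₂ * c₁⁻¹) • w,
    Submodule.smul_mem _ _ (mem_ker_of_apply_self_eq_zero hs hB hw), ?_⟩
  ext
  simp only [Submodule.coe_add, Submodule.coe_smul, ← h₁, ← h₂, smul_add, smul_smul,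
    inv_mul_cancel_right₀ hc]
  abel

end Rank

end CubicTMP

namespace CubicTMP

open Polynomial (X C aeval degreeLE)

/-! ### The coordinate ring as Laurent polynomials in y -/

noncomputable section

/-- The value at a point of `C` of an element of `ℝ[C]`. -/
def evalAt {C : Set (Fin 2 → ℝ)} (z : Fin 2 → ℝ) (hz : z ∈ C) : CoordRing C →ₐ[ℝ] ℝ :=
  Ideal.Quotient.liftₐ (MvPolynomial.vanishingIdeal ℝ C) (MvPolynomial.aeval z)
    fun _ hp => MvPolynomial.mem_vanishingIdeal_iff.1 hp z hz

theorem evalAt_toCoord {C : Set (Fin 2 → ℝ)} {z : Fin 2 → ℝ} (hz : z ∈ C) (p : Poly) :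
    evalAt z hz (toCoord C p) = MvPolynomial.eval z p :=
  rfl

theorem ne_zero_of_irreducible {a e : ℝ} (h : Irreducible (P6 a 0 e)) : e ≠ 0 := by
  rintro rfl
  have h1 : P6 a 0 0 = MvPolynomial.X 1 *
      (MvPolynomial.X 0 * MvPolynomial.X 1 + MvPolynomial.C a) := by
    simp only [P6, map_zero]
    ring
  rcases h.isUnit_or_isUnit h1 with h2 | h2
  · have := h2.map (MvPolynomial.eval (0 : Fin 2 → ℝ))
    simp at this
  -- The second factor xy + a vanishes at (−a, 1).
  · have := h2.map (MvPolynomial.eval (![-a, 1] : Fin 2 → ℝ))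
    simp at this

variable {a e : ℝ}

local notation "R" => CoordRing (curve6 a 0 e)
local notation "x" => xC a 0 e
local notation "y" => yC a 0 e

/-- The point of the curve `x y² + a y = e` with second coordinate `t`. -/
def curvePoint (a e t : ℝ) : Fin 2 → ℝ := ![e / t ^ 2 - a / t, t]

theorem curvePoint_mem {t : ℝ} (ht : t ≠ 0) : curvePoint a e t ∈ curve6 a 0 e := by
  simp only [curve6, zeroSet, P6, curvePoint, Set.mem_ofPred_eq]
  simp
  field_simp
  ring

/-- The inverse of `y` in `ℝ[C]`. -/
def yInv (a e : ℝ) : CoordRing (curve6 a 0 e) :=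
  algebraMap ℝ _ e⁻¹ * (xC a 0 e * yC a 0 e + algebraMap ℝ _ a)

theorem x_mul_y_sq : x * y ^ 2 = algebraMap ℝ R e - algebraMap ℝ R a * y := by
  rw [curve6_relation, zero_smul, zero_add, Algebra.smul_def, Algebra.smul_def, mul_one]

theorem algebraMap_mul_yInv (he : e ≠ 0) :
    algebraMap ℝ R e * yInv a e = x * y + algebraMap ℝ R a := by
  rw [yInv, ← mul_assoc, ← map_mul, mul_inv_cancel₀ he, map_one, one_mul]

theorem y_mul_yInv (he : e ≠ 0) : y * yInv a e = 1 := by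
  have h : algebraMap ℝ R e⁻¹ * algebraMap ℝ R e = 1 := by
    rw [← map_mul, inv_mul_cancel₀ he, map_one]
  rw [yInv]
  linear_combination algebraMap ℝ R e⁻¹ * x_mul_y_sq (a := a) (e := e) + h

theorem algebraMap_mul_yInv_sq (he : e ≠ 0) :
    algebraMap ℝ R e * yInv a e ^ 2 = x + algebraMap ℝ R a * yInv a e := by
  linear_combination yInv a e * algebraMap_mul_yInv (a := a) he +
    x * y_mul_yInv (a := a) he

theorem evalAt_y {t : ℝ} (ht : t ≠ 0) :
    evalAt (curvePoint a e t) (curvePoint_mem ht) (yC a 0 e) = t := by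
  rw [yC, evalAt_toCoord]
  simp [curvePoint]

theorem evalAt_yInv {t : ℝ} (ht : t ≠ 0) (he : e ≠ 0) :
    evalAt (curvePoint a e t) (curvePoint_mem ht) (yInv a e) = t⁻¹ := by
  have h := congrArg (evalAt (curvePoint a e t) (curvePoint_mem ht)) (y_mul_yInv (a := a) he)
  rw [map_mul, map_one, evalAt_y ht] at h
  exact eq_inv_of_mul_eq_one_right h

/-- The linear map `f ↦ y^(-2m) f(y)` from `ℝ[X]` to `ℝ[C]`. -/
def ofPoly (a e : ℝ) (m : ℕ) : Polynomial ℝ →ₗ[ℝ] CoordRing (curve6 a 0 e) :=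
  (LinearMap.mulLeft ℝ (yInv a e ^ (2 * m))).comp (aeval (yC a 0 e)).toLinearMap

theorem ofPoly_apply (m : ℕ) (f : Polynomial ℝ) :
    ofPoly a e m f = yInv a e ^ (2 * m) * aeval y f :=
  rfl

theorem ofPoly_mul (k : ℕ) (f g : Polynomial ℝ) :
    ofPoly a e k f * ofPoly a e k g = ofPoly a e (2 * k) (f * g) := by
  simp only [ofPoly_apply, map_mul]
  ring

theorem evalAt_ofPoly {t : ℝ} (ht : t ≠ 0) (he : e ≠ 0) (m : ℕ) (f : Polynomial ℝ) :
    evalAt (curvePoint a e t) (curvePoint_mem ht) (ofPoly a e m f) =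
      t⁻¹ ^ (2 * m) * f.eval t := by
  rw [ofPoly_apply, map_mul, map_pow, evalAt_yInv ht he, ← Polynomial.aeval_algHom_apply,
    evalAt_y ht, Polynomial.coe_aeval_eq_eval]

theorem ofPoly_injective (he : e ≠ 0) (m : ℕ) : Function.Injective (ofPoly a e m) := by
  rw [← LinearMap.ker_eq_bot, LinearMap.ker_eq_bot']
  intro f hf
  refine Polynomial.eq_zero_of_infinite_isRoot f
    (Set.Infinite.mono (s := ({0} : Set ℝ)ᶜ) ?_ (Set.finite_singleton _).infinite_compl)
  intro t ht
  have ht' : t ≠ 0 := ht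
  have h := evalAt_ofPoly (a := a) ht' he m f
  rw [hf, map_zero] at h
  simpa [ht'] using h

/-- Each factor x is y⁻²(e − a y); the i factors use up y^(−2i) of the normalisation y^(−2m), and
the unused part is compensated by X^(2(m − i)). -/
theorem x_pow_mul_y_pow (he : e ≠ 0) {m i : ℕ} (hi : i ≤ m) (j : ℕ) :
    x ^ i * y ^ j =
      ofPoly a e m ((C e - C a * X) ^ i * X ^ (2 * (m - i) + j)) := by
  obtain ⟨n, rfl⟩ := Nat.exists_eq_add_of_le hi
  have h : aeval y (C e - C a * X) = x * y ^ 2 := by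
    rw [x_mul_y_sq]
    simp
  rw [ofPoly_apply, map_mul, map_pow, h, map_pow, Polynomial.aeval_X, Nat.add_sub_cancel_left]
  have h2 : (y * yInv a e) ^ (2 * (i + n)) = 1 := by rw [y_mul_yInv he, one_pow]
  linear_combination (-(x ^ i * y ^ j)) * h2

theorem x_pow_eq (he : e ≠ 0) (m : ℕ) : x ^ m = ofPoly a e m ((C e - C a * X) ^ m) := by
  simpa using x_pow_mul_y_pow (a := a) he (le_refl m) 0

theorem y_pow_eq (he : e ≠ 0) (m j : ℕ) : y ^ j = ofPoly a e m (X ^ (2 * m + j)) := by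
  simpa using x_pow_mul_y_pow (a := a) he (Nat.zero_le m) j

/-! ### U, V, W, Z in terms of pole order at 0 and degree in y -/

/-- The elements `y^(j - 2k) f(y)` of `ℝ[C]` with `deg f ≤ n`. -/
def polySpace (a e : ℝ) (k j n : ℕ) : Submodule ℝ (CoordRing (curve6 a 0 e)) :=
  (degreeLE ℝ n).map ((ofPoly a e k).comp (LinearMap.mulLeft ℝ (X ^ j)))

theorem mem_polySpace {k j n : ℕ} {f : CoordRing (curve6 a 0 e)} :
    f ∈ polySpace a e k j n ↔
      ∃ F : Polynomial ℝ, F.natDegree ≤ n ∧ ofPoly a e k (X ^ j * F) = f := by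
  simp only [polySpace, Submodule.mem_map, Polynomial.mem_degreeLE,
    ← Polynomial.natDegree_le_iff_degree_le]
  rfl

instance (k j n : ℕ) : FiniteDimensional ℝ (polySpace a e k j n) := by
  have : FiniteDimensional ℝ (degreeLE ℝ n) := by
    rw [Polynomial.degreeLE_eq_span_X_pow]
    infer_instance
  rw [polySpace]
  infer_instance

theorem natDegree_linear_pow_le (i : ℕ) : ((C e - C a * X) ^ i).natDegree ≤ i := by
  refine Polynomial.natDegree_pow_le.trans ?_
  have : (C e - C a * X).natDegree ≤ 1 := by compute_degree
  nlinarith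

theorem monomial_mem_polySpace (he : e ≠ 0) {k j n i l : ℕ} (hi : i ≤ k)
    (hj : j ≤ 2 * (k - i) + l) (hn : 2 * k + l ≤ n + i + j) :
    x ^ i * y ^ l ∈ polySpace a e k j n := by
  refine mem_polySpace.2 ⟨(C e - C a * X) ^ i * X ^ (2 * (k - i) + l - j), ?_, ?_⟩
  · refine Polynomial.natDegree_mul_le.trans ?_
    rw [Polynomial.natDegree_X_pow]
    have := natDegree_linear_pow_le (a := a) (e := e) i
    omega
  · rw [x_pow_mul_y_pow he hi]
    congr 1
    rw [mul_left_comm, ← pow_add]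
    congr 2
    omega

theorem x_pow_notMem_polySpace (he : e ≠ 0) {k j n : ℕ} (hj : 1 ≤ j) :
    x ^ k ∉ polySpace a e k j n := by
  intro h
  obtain ⟨F, -, hF⟩ := mem_polySpace.1 h
  rw [x_pow_eq he] at hF
  have := congrArg (Polynomial.eval 0) (ofPoly_injective he k hF)
  have hj' : j ≠ 0 := by omega
  simp [hj', he, eq_comm] at this

theorem y_pow_notMem_polySpace (he : e ≠ 0) {k j n : ℕ} (hjn : j + n < 3 * k) :
    y ^ k ∉ polySpace a e k j n := by
  intro h
  obtain ⟨F, hFn, hF⟩ := mem_polySpace.1 h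
  rw [y_pow_eq he k] at hF
  have h1 := congrArg Polynomial.natDegree (ofPoly_injective he k hF)
  have h2 := Polynomial.natDegree_mul_le (p := (X : Polynomial ℝ) ^ j) (q := F)
  rw [h1, Polynomial.natDegree_X_pow, Polynomial.natDegree_X_pow] at h2
  omega

theorem monomial_mem_spaceU (he : e ≠ 0) {k i l : ℕ} (hi : i < k)
    (h : l ≤ 1 ∨ i = 0 ∧ l ≤ k) : x ^ i * y ^ l ∈ spaceU a 0 e k := by
  refine Submodule.subset_span ⟨?_, fun hk => ?_⟩
  · rcases Nat.eq_zero_or_pos i with rfl | hi0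
    · exact Or.inr (Or.inr ⟨l, by omega, by simp⟩)
    · refine Or.inr (Or.inl ⟨i, hi0, hi, ?_⟩)
      obtain rfl | rfl : l = 0 ∨ l = 1 := by omega
      · simp
      · simp
  -- The spaces are spans of set differences, so the monomial must be shown distinct from x^k in
  -- ℝ[C]: it has smaller pole order at y = 0.
  · refine x_pow_notMem_polySpace (a := a) he (k := k) (j := 1) (n := 2 * k + l) le_rfl ?_
    rw [← Set.mem_singleton_iff.1 hk]
    exact monomial_mem_polySpace he hi.le (by omega) (by omega)

theorem spaceU_le_spaceV (k : ℕ) : spaceU a 0 e k ≤ spaceV a 0 e k :=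
  Submodule.span_mono Set.subset_union_left

theorem x_pow_mul_y_mem_spaceV (k : ℕ) : x ^ k * y ∈ spaceV a 0 e k :=
  Submodule.subset_span (Or.inr rfl)

/-- Rewriting e y⁻² = x + a y⁻¹ trades y⁻² for x without raising the pole order 2i + b, until e y⁻¹
= xy + a finishes. -/
theorem yInv_pow_mul_x_pow_mem (he : e ≠ 0) {S : Submodule ℝ (CoordRing (curve6 a 0 e))} {N : ℕ}
    (h0 : ∀ i, 2 * i ≤ N → x ^ i ∈ S) (h1 : ∀ i, 2 * i + 1 ≤ N → x ^ (i + 1) * y ∈ S) (b : ℕ) :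
    ∀ i, 2 * i + b ≤ N → yInv a e ^ b * x ^ i ∈ S := by
  have hcancel : ∀ f : CoordRing (curve6 a 0 e), algebraMap ℝ _ e * f ∈ S → f ∈ S := by
    intro f hf
    rw [← Algebra.smul_def] at hf
    simpa [he] using S.smul_mem e⁻¹ hf
  induction b using Nat.strong_induction_on with
  | _ b ih =>
    intro i hi
    match b, ih with
    | 0, _ => simpa using h0 i (by omega)
    | 1, _ =>
      apply hcancel
      have : algebraMap ℝ R e * (yInv a e ^ 1 * x ^ i) = x ^ (i + 1) * y + a • x ^ i := by
        rw [Algebra.smul_def]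
        linear_combination x ^ i * algebraMap_mul_yInv (a := a) he
      rw [this]
      exact S.add_mem (h1 i hi) (S.smul_mem _ (h0 i (by omega)))
    | b + 2, ih =>
      apply hcancel
      have : algebraMap ℝ R e * (yInv a e ^ (b + 2) * x ^ i) =
          yInv a e ^ b * x ^ (i + 1) + a • (yInv a e ^ (b + 1) * x ^ i) := by
        rw [Algebra.smul_def]
        linear_combination yInv a e ^ b * x ^ i * algebraMap_mul_yInv_sq (a := a) he
      rw [this]
      exact S.add_mem (ih b (by omega) _ (by omega))
        (S.smul_mem _ (ih (b + 1) (by omega) _ (by omega)))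

theorem polySpace_le (he : e ≠ 0) {S : Submodule ℝ (CoordRing (curve6 a 0 e))} {k j n N : ℕ}
    (hNj : N + j = 2 * k) (hnj : n + j ≤ 3 * k)
    (h0 : ∀ i, 2 * i ≤ N → x ^ i ∈ S) (h1 : ∀ i, 2 * i + 1 ≤ N → x ^ (i + 1) * y ∈ S)
    (h2 : ∀ i, i ≤ k → y ^ i ∈ S) : polySpace a e k j n ≤ S := by
  rw [polySpace, Polynomial.degreeLE_eq_span_X_pow, Submodule.map_span_le]
  intro f hf
  simp only [Finset.coe_image, Finset.coe_range, Set.mem_image, Set.mem_Iio] at hf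
  obtain ⟨i, hi, rfl⟩ := hf
  change yInv a e ^ (2 * k) * aeval y (X ^ j * X ^ i) ∈ S
  rw [← pow_add, map_pow, Polynomial.aeval_X]
  rcases le_total (2 * k) (j + i) with h | h
  · obtain ⟨c, hc⟩ := Nat.exists_eq_add_of_le h
    have : yInv a e ^ (2 * k) * y ^ (j + i) = y ^ c := by
      have h3 : (y * yInv a e) ^ (2 * k) = 1 := by rw [y_mul_yInv he, one_pow]
      rw [hc]
      linear_combination y ^ c * h3
    rw [this]
    exact h2 c (by omega)
  · obtain ⟨c, hc⟩ := Nat.exists_eq_add_of_le h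
    have : yInv a e ^ (2 * k) * y ^ (j + i) = yInv a e ^ c * x ^ 0 := by
      have h3 : (y * yInv a e) ^ (j + i) = 1 := by rw [y_mul_yInv he, one_pow]
      rw [hc]
      linear_combination yInv a e ^ c * h3
    rw [this]
    exact yInv_pow_mul_x_pow_mem he h0 h1 c 0 (by omega)

/-- The elements x^i and x^i y have pole orders 2i and 2i − 1 at y = 0. Dropping x^k leaves orders
at most 2k − 2; adding x^k y for V^(k) allows 2k − 1. -/
theorem spaceU_eq (he : e ≠ 0) {k : ℕ} (hk : 1 ≤ k) :
    spaceU a 0 e k = polySpace a e k 2 (3 * k - 2) := by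
  refine le_antisymm (Submodule.span_le.2 ?_)
    (polySpace_le he (N := 2 * k - 2) (by omega) (by omega) ?_ ?_ ?_)
  · rintro g ⟨rfl | ⟨i, hi, hik, rfl | rfl⟩ | ⟨j, hj, rfl⟩, hne⟩
    · exact absurd rfl hne
    · simpa using monomial_mem_polySpace (a := a) he (k := k) (j := 2) (n := 3 * k - 2) (i := i)
        (l := 0) (by omega) (by omega) (by omega)
    · simpa using monomial_mem_polySpace (a := a) he (k := k) (j := 2) (n := 3 * k - 2) (i := i)
        (l := 1) (by omega) (by omega) (by omega)
    · simpa using monomial_mem_polySpace (a := a) he (k := k) (j := 2) (n := 3 * k - 2) (i := 0)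
        (l := j) (by omega) (by omega) (by omega)
  · intro i hi
    simpa using monomial_mem_spaceU (a := a) he (k := k) (i := i) (l := 0) (by omega) (by omega)
  · intro i hi
    simpa using monomial_mem_spaceU (a := a) he (k := k) (i := i + 1) (l := 1) (by omega)
      (by omega)
  · intro i hi
    simpa using monomial_mem_spaceU (a := a) he (k := k) (i := 0) (l := i) (by omega) (by omega)

theorem spaceV_eq (he : e ≠ 0) {k : ℕ} (hk : 1 ≤ k) :
    spaceV a 0 e k = polySpace a e k 1 (3 * k - 1) := by
  refine le_antisymm (Submodule.span_le.2 ?_)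
    (polySpace_le he (N := 2 * k - 1) (by omega) (by omega) ?_ ?_ ?_)
  · rintro g (⟨rfl | ⟨i, hi, hik, rfl | rfl⟩ | ⟨j, hj, rfl⟩, hne⟩ | rfl)
    · exact absurd rfl hne
    · simpa using monomial_mem_polySpace (a := a) he (k := k) (j := 1) (n := 3 * k - 1) (i := i)
        (l := 0) (by omega) (by omega) (by omega)
    · simpa using monomial_mem_polySpace (a := a) he (k := k) (j := 1) (n := 3 * k - 1) (i := i)
        (l := 1) (by omega) (by omega) (by omega)
    · simpa using monomial_mem_polySpace (a := a) he (k := k) (j := 1) (n := 3 * k - 1) (i := 0)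
        (l := j) (by omega) (by omega) (by omega)
    · simpa using monomial_mem_polySpace (a := a) he (k := k) (j := 1) (n := 3 * k - 1) (i := k)
        (l := 1) (by omega) (by omega) (by omega)
  · intro i hi
    refine spaceU_le_spaceV k ?_
    simpa using monomial_mem_spaceU (a := a) he (k := k) (i := i) (l := 0) (by omega) (by omega)
  · intro i hi
    rcases eq_or_ne (i + 1) k with rfl | h
    · exact x_pow_mul_y_mem_spaceV _
    · refine spaceU_le_spaceV k ?_
      simpa using monomial_mem_spaceU (a := a) he (k := k) (i := i + 1) (l := 1) (by omega)
        (by omega)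
  · intro i hi
    refine spaceU_le_spaceV k ?_
    simpa using monomial_mem_spaceU (a := a) he (k := k) (i := 0) (l := i) (by omega) (by omega)

/-- Without y^k the degree 3k is not reached. This inclusion is all that is needed to detect a y^k
term. -/
theorem spaceW_le_polySpace (he : e ≠ 0) {k : ℕ} (hk : 1 ≤ k) :
    spaceW a 0 e k ≤ polySpace a e k 0 (3 * k - 1) := by
  refine Submodule.span_le.2 ?_
  rintro g ⟨rfl | ⟨i, hi, hik, rfl | rfl⟩ | ⟨j, hj, rfl⟩, hne⟩
  · simpa using monomial_mem_polySpace (a := a) he (k := k) (j := 0) (n := 3 * k - 1) (i := k)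
      (l := 0) (by omega) (by omega) (by omega)
  · simpa using monomial_mem_polySpace (a := a) he (k := k) (j := 0) (n := 3 * k - 1) (i := i)
      (l := 0) (by omega) (by omega) (by omega)
  · simpa using monomial_mem_polySpace (a := a) he (k := k) (j := 0) (n := 3 * k - 1) (i := i)
      (l := 1) (by omega) (by omega) (by omega)
  · have hjk : j ≠ k := by rintro rfl; exact hne rfl
    simpa using monomial_mem_polySpace (a := a) he (k := k) (j := 0) (n := 3 * k - 1) (i := 0)
      (l := j) (by omega) (by omega) (by omega)

theorem spaceZ_le_polySpace (he : e ≠ 0) {k : ℕ} (hk : 1 ≤ k) :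
    spaceZ a 0 e k ≤ polySpace a e k 1 (3 * k - 2) := by
  refine Submodule.span_le.2 ?_
  rintro g ⟨⟨rfl | ⟨i, hi, hik, rfl | rfl⟩ | ⟨j, hj, rfl⟩, hne⟩ | rfl, hne'⟩
  · exact absurd rfl hne
  · simpa using monomial_mem_polySpace (a := a) he (k := k) (j := 1) (n := 3 * k - 2) (i := i)
      (l := 0) (by omega) (by omega) (by omega)
  · simpa using monomial_mem_polySpace (a := a) he (k := k) (j := 1) (n := 3 * k - 2) (i := i)
      (l := 1) (by omega) (by omega) (by omega)
  · have hjk : j ≠ k := by rintro rfl; exact hne' rfl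
    simpa using monomial_mem_polySpace (a := a) he (k := k) (j := 1) (n := 3 * k - 2) (i := 0)
      (l := j) (by omega) (by omega) (by omega)
  · simpa using monomial_mem_polySpace (a := a) he (k := k) (j := 1) (n := 3 * k - 2) (i := k)
      (l := 1) (by omega) (by omega) (by omega)

theorem coordLE_le {S : Submodule ℝ (CoordRing (curve6 a 0 e))} {m : ℕ}
    (h : ∀ i j, i + j ≤ m → x ^ i * y ^ j ∈ S) : CoordLE (curve6 a 0 e) m ≤ S := by
  rintro _ ⟨p, hp, rfl⟩
  rw [AlgHom.toLinearMap_apply, p.as_sum, map_sum]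
  refine S.sum_mem fun s hs => ?_
  have h1 : s.degree ≤ m :=
    (MvPolynomial.le_totalDegree hs).trans ((MvPolynomial.mem_restrictTotalDegree _ _ _).1 hp)
  rw [MvPolynomial.monomial_eq, map_mul, ← MvPolynomial.algebraMap_eq, AlgHom.commutes,
    ← Algebra.smul_def, Finsupp.prod_fintype _ _ (by simp), Fin.prod_univ_two, map_mul, map_pow,
    map_pow]
  refine S.smul_mem _ (h (s 0) (s 1) ?_)
  rwa [Finsupp.degree_eq_sum, Fin.sum_univ_two] at h1

theorem coordLE_le_sup_x_pow (he : e ≠ 0) {k : ℕ} (hk : 1 ≤ k) :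
    CoordLE (curve6 a 0 e) k ≤ spaceU a 0 e k ⊔ Submodule.span ℝ {x ^ k} := by
  refine coordLE_le fun i j hij => ?_
  rcases eq_or_ne i k with rfl | hik
  · obtain rfl : j = 0 := by omega
    refine Submodule.mem_sup_right ?_
    simp
  · refine Submodule.mem_sup_left ?_
    rw [spaceU_eq he hk]
    exact monomial_mem_polySpace he (by omega) (by omega) (by omega)

theorem spaceU_le_sup_y_pow (k : ℕ) :
    spaceU a 0 e k ≤ spaceW a 0 e k ⊔ Submodule.span ℝ {y ^ k} := by
  rw [spaceW, ← Submodule.span_union]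
  refine Submodule.span_mono fun g hg => ?_
  by_cases h : g = y ^ k
  · exact Or.inr h
  · exact Or.inl ⟨hg.1, h⟩

theorem x_pow_mem_spaceW (he : e ≠ 0) {k : ℕ} (hk : 1 ≤ k) : x ^ k ∈ spaceW a 0 e k := by
  refine Submodule.subset_span ⟨Or.inl rfl, fun h => ?_⟩
  refine y_pow_notMem_polySpace (a := a) he (k := k) (j := 0) (n := k) (by omega) ?_
  rw [← Set.mem_singleton_iff.1 h]
  simpa using monomial_mem_polySpace (a := a) he (k := k) (j := 0) (n := k) (i := k)
    (l := 0) (by omega) (by omega) (by omega)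

theorem coordLE_le_sup_y_pow (he : e ≠ 0) {k : ℕ} (hk : 1 ≤ k) :
    CoordLE (curve6 a 0 e) k ≤ spaceW a 0 e k ⊔ Submodule.span ℝ {y ^ k} :=
  (coordLE_le_sup_x_pow he hk).trans (sup_le (spaceU_le_sup_y_pow k)
    ((Submodule.span_singleton_le_iff_mem _ _).2
      (Submodule.mem_sup_left (x_pow_mem_spaceW he hk))))

theorem spaceV_le_sup_y_pow (k : ℕ) :
    spaceV a 0 e k ≤ spaceZ a 0 e k ⊔ Submodule.span ℝ {y ^ k} := by
  rw [spaceZ, ← Submodule.span_union]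
  refine Submodule.span_mono fun g hg => ?_
  by_cases h : g = y ^ k
  · exact Or.inr h
  · exact Or.inl ⟨hg, h⟩

/-- The condition on `F` for `y^(-2m) F(y)` to lie in `ℝ[C]_{≤ m}`. -/
theorem exists_of_mem_coordLE (he : e ≠ 0) {m : ℕ} {f : CoordRing (curve6 a 0 e)}
    (hf : f ∈ CoordLE (curve6 a 0 e) m) :
    ∃ F : Polynomial ℝ, F.natDegree ≤ 3 * m ∧ e * F.coeff 1 + m * a * F.coeff 0 = 0 ∧
      ofPoly a e m F = f := by
  -- Only x^m, that is (e − aX)^m, contributes below X²; its two lowest coefficients e^m and −m a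
  -- e^(m−1) are related by φ = 0.
  let φ : Polynomial ℝ →ₗ[ℝ] ℝ := e • Polynomial.lcoeff ℝ 1 + (m * a) • Polynomial.lcoeff ℝ 0
  have hφ : ∀ F, φ F = e * F.coeff 1 + m * a * F.coeff 0 := fun F => by simp [φ]
  have h : CoordLE (curve6 a 0 e) m ≤
      (degreeLE ℝ (3 * m : ℕ) ⊓ LinearMap.ker φ).map (ofPoly a e m) := by
    refine coordLE_le fun i j hij => ⟨_, ⟨?_, ?_⟩, (x_pow_mul_y_pow he (by omega) j).symm⟩
    · rw [SetLike.mem_coe, Polynomial.mem_degreeLE, ← Polynomial.natDegree_le_iff_degree_le]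
      refine Polynomial.natDegree_mul_le.trans ?_
      rw [Polynomial.natDegree_X_pow]
      have := natDegree_linear_pow_le (a := a) (e := e) i
      omega
    · rw [SetLike.mem_coe, LinearMap.mem_ker, hφ]
      rcases eq_or_ne i m with rfl | him
      · obtain rfl : j = 0 := by omega
        have h1 : ((C e - C a * X) ^ i).coeff 1 = i * e ^ (i - 1) * (-a) := by
          have h2 := Polynomial.coeff_derivative ((C e - C a * X) ^ i) 0
          rw [Polynomial.coeff_zero_eq_eval_zero] at h2
          simpa [Polynomial.derivative_pow] using h2.symm
        rw [Nat.sub_self, mul_zero, add_zero, pow_zero, mul_one, h1,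
          Polynomial.coeff_zero_eq_eval_zero]
        rcases i with _ | i
        · simp
        · simp
          ring
      · obtain ⟨c, hc⟩ : ∃ c, 2 * (m - i) + j = c + 2 := ⟨2 * (m - i) + j - 2, by omega⟩
        rw [hc, Polynomial.coeff_mul_X_pow', Polynomial.coeff_mul_X_pow']
        simp
  obtain ⟨F, ⟨hF1, hF2⟩, rfl⟩ := h hf
  exact ⟨F, Polynomial.natDegree_le_iff_degree_le.2 (Polynomial.mem_degreeLE.1 hF1),
    by rw [← hφ]; exact hF2, rfl⟩

end

end CubicTMP

namespace CubicTMP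

open Polynomial (X C aeval)

/-! ### Transfer between the curve and the line -/

section CubicCurve

variable {a e : ℝ}

local notation "R" => CoordRing (curve6 a 0 e)
local notation "x" => xC a 0 e
local notation "y" => yC a 0 e

/-- Subtracting the multiple of x^k that kills the constant term also kills the linear one, by the
relation; what remains lies in U. -/
theorem mem_coordLE_of_coeff (he : e ≠ 0) {k : ℕ} (hk : 1 ≤ k) {F : Polynomial ℝ}
    (hF : F.natDegree ≤ 3 * k) (hc : e * F.coeff 1 + k * a * F.coeff 0 = 0) :
    ofPoly a e k F ∈ CoordLE (curve6 a 0 e) k := by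
  have hx := monomial_mem_coordLE a 0 e (i := k) (j := 0) (m := k) le_rfl
  rw [pow_zero, mul_one] at hx
  obtain ⟨E, hE, hEc, hEx⟩ := exists_of_mem_coordLE he hx
  have hE0 : E.coeff 0 ≠ 0 := by
    have := ofPoly_injective (a := a) he k (hEx.trans (x_pow_eq he k))
    rw [this, Polynomial.coeff_zero_eq_eval_zero]
    simp [he]
  set c := F.coeff 0 / E.coeff 0
  have h0 : (F - c • E).coeff 0 = 0 := by
    simp [c, hE0]
  have h1 : (F - c • E).coeff 1 = 0 := by
    rw [Polynomial.coeff_sub, Polynomial.coeff_smul, smul_eq_mul]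
    have hcE : c * E.coeff 0 = F.coeff 0 := div_mul_cancel₀ _ hE0
    apply mul_left_cancel₀ he
    linear_combination hc - c * hEc + k * a * hcE
  obtain ⟨G, hG⟩ : X ^ 2 ∣ F - c • E := by
    refine Polynomial.X_pow_dvd_iff.2 fun d hd => ?_
    interval_cases d
    · exact h0
    · exact h1
  have hGn : G.natDegree ≤ 3 * k - 2 := by
    rcases eq_or_ne G 0 with rfl | hG0
    · simp
    · have h2 : (F - c • E).natDegree ≤ 3 * k :=
        (Polynomial.natDegree_sub_le _ _).trans
          (max_le hF ((Polynomial.natDegree_smul_le _ _).trans hE))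
      rw [hG, Polynomial.natDegree_X_pow_mul 2 hG0] at h2
      omega
  have hU : ofPoly a e k (X ^ 2 * G) ∈ spaceU a 0 e k := by
    rw [spaceU_eq he hk]
    exact mem_polySpace.2 ⟨G, hGn, rfl⟩
  have : ofPoly a e k F = ofPoly a e k (X ^ 2 * G) + c • x ^ k := by
    rw [← hG, ← hEx, ← map_smul, ← map_add, sub_add_cancel]
  rw [this]
  exact Submodule.add_mem _ (spaceU_le a 0 e k hU) (Submodule.smul_mem _ _ hx)

theorem ofPoly_mul_mem_coordLE (he : e ≠ 0) {k : ℕ} (hk : 1 ≤ k) {F G : Polynomial ℝ}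
    (hF : F.natDegree ≤ 3 * k - 1) (hG : G.natDegree ≤ 3 * k - 1) :
    ofPoly a e k (X * F) * ofPoly a e k (X * G) ∈ CoordLE (curve6 a 0 e) (2 * k) := by
  have := spaceV_mul_mem a 0 e hk (ofPoly a e k (X * F))
    (by rw [spaceV_eq he hk]; exact mem_polySpace.2 ⟨F, hF, by rw [pow_one]⟩)
    (ofPoly a e k (X * G))
    (by rw [spaceV_eq he hk]; exact mem_polySpace.2 ⟨G, hG, by rw [pow_one]⟩)
  rwa [one_mul] at this

/-- A functional on `ℝ[C]_{≤ 2k}` that is positive on squares of `ℝ[C]_{≤ k}` and of `V^(k)` and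
has isotropic elements `y^(-2k) P(y)` with `P(0) ≠ 0` and `y^(-2k) Q(y)` with `Q` monic of degree
`3k` is atomic. -/
theorem exists_atomic_on_curve (he : e ≠ 0) {k : ℕ} (hk : 1 ≤ k)
    (ℓ : CoordRing (curve6 a 0 e) →ₗ[ℝ] ℝ)
    (hR : ∀ g ∈ CoordLE (curve6 a 0 e) k, 0 ≤ ℓ (g * g))
    (hV : ∀ g ∈ spaceV a 0 e k, 0 ≤ ℓ (g * g))
    {P : Polynomial ℝ} (hP : P.natDegree ≤ 3 * k) (hP0 : P.coeff 0 ≠ 0)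
    (hPR : ofPoly a e k P ∈ CoordLE (curve6 a 0 e) k)
    (hPi : ℓ (ofPoly a e k P * ofPoly a e k P) = 0)
    {Q : Polynomial ℝ} (hQ : Q.Monic) (hQn : Q.natDegree = 3 * k)
    (hQR : ofPoly a e k Q * ofPoly a e k Q ∈ CoordLE (curve6 a 0 e) (2 * k))
    (hQi : ℓ (ofPoly a e k Q * ofPoly a e k Q) = 0) :
    ∃ (S : Finset ℝ) (w : ℝ → ℝ), (∀ s ∈ S, s ≠ 0) ∧ (∀ s ∈ S, 0 ≤ w s) ∧
      ∀ p ∈ PolyLE (2 * k), ℓ (toCoord (curve6 a 0 e) p) =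
        ∑ s ∈ S, w s * MvPolynomial.eval (curvePoint a e s) p := by
  -- XP has constant term 0 and linear term P(0) ≠ 0, violating the coefficient relation. Its value
  -- is therefore free, and 0 is chosen.
  have hw : ofPoly a e (2 * k) (X * P) ∉ CoordLE (curve6 a 0 e) (2 * k) := by
    intro h
    obtain ⟨F, -, hFc, hF⟩ := exists_of_mem_coordLE he h
    rw [ofPoly_injective he _ hF] at hFc
    simp [he, hP0] at hFc
  obtain ⟨Λ, hΛ, hΛw⟩ := LinearMap.exists_extend_of_notMem
    (ℓ.domRestrict (CoordLE (curve6 a 0 e) (2 * k))) hw 0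
  have hΛℓ : ∀ f ∈ CoordLE (curve6 a 0 e) (2 * k), Λ f = ℓ f := fun f hf =>
    LinearMap.congr_fun hΛ ⟨f, hf⟩
  let M : Polynomial ℝ →ₗ[ℝ] ℝ := Λ.comp (ofPoly a e (2 * k))
  have hM : ∀ f, M f = Λ (ofPoly a e (2 * k) f) := fun f => rfl
  have hPg : ∀ g ∈ CoordLE (curve6 a 0 e) k, ℓ (ofPoly a e k P * g) = 0 := fun g hg =>
    apply_mul_eq_zero_of_isotropic ℓ _ hR hPR hg hPi
  have hsplit : ∀ h : Polynomial ℝ, h.natDegree ≤ 3 * k → ∃ c : ℝ, ∃ g : Polynomial ℝ,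
      g.natDegree ≤ 3 * k - 1 ∧ h = c • P + X * g := by
    intro h hh
    set c := h.coeff 0 / P.coeff 0
    obtain ⟨g, hg⟩ : X ∣ h - c • P := Polynomial.X_dvd_iff.2 (by simp [c, hP0])
    refine ⟨c, g, ?_, by rw [← hg]; ring⟩
    rcases eq_or_ne g 0 with rfl | hg0
    · simp
    · have h2 : (h - c • P).natDegree ≤ 3 * k :=
        (Polynomial.natDegree_sub_le _ _).trans
          (max_le hh ((Polynomial.natDegree_smul_le _ _).trans hP))
      rw [hg, Polynomial.natDegree_X_mul hg0] at h2
      omega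
  have hPX : ∀ g : Polynomial ℝ, g.natDegree ≤ 3 * k - 1 → M (P * (X * g)) = 0 := by
    intro g hg
    have hgX : g = X * g.divX + C (g.coeff 0) := (Polynomial.X_mul_divX_add g).symm
    have hd : g.divX.natDegree ≤ 3 * k - 2 := by
      rw [Polynomial.natDegree_divX_eq_natDegree_tsub_one]
      omega
    have hU : ofPoly a e k (X ^ 2 * g.divX) ∈ CoordLE (curve6 a 0 e) k := by
      refine spaceU_le a 0 e k ?_
      rw [spaceU_eq he hk]
      exact mem_polySpace.2 ⟨_, hd, rfl⟩
    -- The first summand vanishes by isotropy of P against U, the second by the choice of the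
    -- extension.
    have h1 : P * (X * g) = P * (X ^ 2 * g.divX) + g.coeff 0 • (X * P) := by
      rw [Polynomial.smul_eq_C_mul]
      linear_combination P * X * hgX
    rw [h1, map_add, map_smul, hM, hM, hΛw, smul_zero, add_zero, ← ofPoly_mul,
      hΛℓ _ (mul_mem_coordLE hPR hU), hPg _ hU]
  have hPP : M (P * P) = 0 := by
    rw [hM, ← ofPoly_mul, hΛℓ _ (mul_mem_coordLE hPR hPR), hPi]
  have hpos : ∀ f : Polynomial ℝ, f.natDegree ≤ 3 * k → 0 ≤ M (f * f) := by
    intro f hf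
    obtain ⟨c, g, hg, rfl⟩ := hsplit f hf
    have h1 : (c • P + X * g) * (c • P + X * g) =
        (c * c) • (P * P) + (2 * c) • (P * (X * g)) + (X * g) * (X * g) := by
      simp only [Polynomial.smul_eq_C_mul, map_mul, map_ofNat]
      ring
    rw [h1, map_add, map_add, map_smul, map_smul, hPP, hPX g hg, smul_zero, smul_zero, zero_add,
      zero_add, hM, ← ofPoly_mul, hΛℓ _ (ofPoly_mul_mem_coordLE he hk hg hg)]
    refine hV _ ?_
    rw [spaceV_eq he hk]
    exact mem_polySpace.2 ⟨g, hg, by rw [pow_one]⟩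
  obtain ⟨S, w, hw0, hrep, hroot⟩ := exists_atomic_of_isotropic_monic M hpos hQ hQn
    (by rw [hM, ← ofPoly_mul, hΛℓ _ hQR, hQi])
  have hS : ∀ s ∈ S, s ≠ 0 := by
    rintro s hs rfl
    have := hroot P hP hPP 0 hs
    rw [← Polynomial.coeff_zero_eq_eval_zero] at this
    exact hP0 this
  -- The factor s^(4k) undoes the normalisation y^(−4k).
  refine ⟨S, fun s => w s * s ^ (2 * (2 * k)), hS, fun s hs => ?_, fun p hp => ?_⟩
  · exact mul_nonneg (hw0 s hs) (Even.pow_nonneg (even_two_mul _) s)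
  · have hpC : toCoord (curve6 a 0 e) p ∈ CoordLE (curve6 a 0 e) (2 * k) := ⟨p, hp, rfl⟩
    obtain ⟨F, hF, -, hFp⟩ := exists_of_mem_coordLE he hpC
    rw [← hΛℓ _ hpC, ← hFp, ← hM, hrep F (by omega)]
    refine Finset.sum_congr rfl fun s hs => ?_
    rw [← evalAt_toCoord (curvePoint_mem (hS s hs)), ← hFp, evalAt_ofPoly (hS s hs) he]
    have h1 : s ^ (2 * (2 * k)) * s⁻¹ ^ (2 * (2 * k)) = 1 := by
      rw [← mul_pow, mul_inv_cancel₀ (hS s hs), one_pow]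
    linear_combination (-(w s * F.eval s)) * h1

theorem isMomentFunctional_of_atomic {m : ℕ} {L : PolyLE m →ₗ[ℝ] ℝ} {S : Finset ℝ} {w : ℝ → ℝ}
    (hS : ∀ s ∈ S, s ≠ 0) (hw : ∀ s ∈ S, 0 ≤ w s)
    (hL : ∀ p : PolyLE m, L p = ∑ s ∈ S, w s * MvPolynomial.eval (curvePoint a e s) p.1) :
    IsMomentFunctional (curve6 a 0 e) L := by
  let μ : MeasureTheory.Measure (Fin 2 → ℝ) :=
    ∑ s ∈ S, ENNReal.ofReal (w s) • MeasureTheory.Measure.dirac (curvePoint a e s)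
  have hμ : μ (curve6 a 0 e)ᶜ = 0 := by
    simp only [μ, MeasureTheory.Measure.coe_finsetSum, Finset.sum_apply,
      MeasureTheory.Measure.smul_apply]
    refine Finset.sum_eq_zero fun s hs => ?_
    rw [MeasureTheory.Measure.dirac_apply, Set.indicator_of_notMem, smul_zero]
    exact fun h => h (curvePoint_mem (hS s hs))
  have hres : μ.restrict (curve6 a 0 e) = μ :=
    MeasureTheory.Measure.restrict_eq_self_of_ae_mem hμ
  have hint : ∀ p : Poly, ∀ s ∈ S, MeasureTheory.Integrable (fun z => MvPolynomial.eval z p)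
      (ENNReal.ofReal (w s) • MeasureTheory.Measure.dirac (curvePoint a e s)) := fun p s _ =>
    (MeasureTheory.integrable_dirac (by simp)).smul_measure ENNReal.ofReal_ne_top
  refine ⟨μ, hμ, fun p => ⟨?_, ?_⟩⟩
  · rw [MeasureTheory.IntegrableOn, hres]
    exact MeasureTheory.integrable_finsetSum_measure.2 (hint p.1)
  · rw [hres, MeasureTheory.integral_finsetSum_measure (hint p.1), hL]
    refine Finset.sum_congr rfl fun s hs => ?_
    rw [MeasureTheory.integral_smul_measure, MeasureTheory.integral_dirac,
      ENNReal.toReal_ofReal (hw s hs), smul_eq_mul]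

theorem measurableSet_curve6 (d : ℝ) : MeasurableSet (curve6 a d e) :=
  (isClosed_eq (MvPolynomial.continuous_eval _) continuous_const).measurableSet

/-- A second expression g for f lets the integrand be read in factored form even when the factors
exceed the degree bound. -/
theorem exists_lift {C : Set (Fin 2 → ℝ)} {m : ℕ} {f g : CoordRing C} (hg : f = g)
    (hf : f ∈ CoordLE C m) : ∃ p ∈ PolyLE m, toCoord C p = f ∧
      ∀ z (hz : z ∈ C), MvPolynomial.eval z p = evalAt z hz g := by
  obtain ⟨p, hp, rfl⟩ := hf
  exact ⟨p, hp, rfl, fun z hz => by rw [← hg]; exact (evalAt_toCoord hz p).symm⟩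

/-- A moment functional is nonnegative on squares. -/
theorem IsMomentFunctional.apply_sq_nonneg {m : ℕ} {L : PolyLE m →ₗ[ℝ] ℝ}
    (h : IsMomentFunctional (curve6 a 0 e) L) {ℓ : CoordRing (curve6 a 0 e) →ₗ[ℝ] ℝ}
    (hℓ : ∀ p : PolyLE m, ℓ (toCoord _ p.1) = L p) (g : CoordRing (curve6 a 0 e))
    (hg : g * g ∈ CoordLE (curve6 a 0 e) m) : 0 ≤ ℓ (g * g) := by
  obtain ⟨μ, -, hμ⟩ := h
  obtain ⟨p, hp, hpg, hpz⟩ := exists_lift rfl hg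
  rw [← hpg, hℓ ⟨p, hp⟩, (hμ ⟨p, hp⟩).2]
  refine MeasureTheory.setIntegral_nonneg (measurableSet_curve6 0) fun z hz => ?_
  rw [hpz z hz, map_mul]
  exact mul_self_nonneg _

/-- Multiples of isotropic elements of a moment functional are isotropic. -/
theorem IsMomentFunctional.apply_sq_mul_eq_zero {m : ℕ} {L : PolyLE m →ₗ[ℝ] ℝ}
    (hm : IsMomentFunctional (curve6 a 0 e) L) {ℓ : CoordRing (curve6 a 0 e) →ₗ[ℝ] ℝ}
    (hℓ : ∀ p : PolyLE m, ℓ (toCoord _ p.1) = L p) {g f h : CoordRing (curve6 a 0 e)}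
    (hg : g * g ∈ CoordLE (curve6 a 0 e) m) (hg0 : ℓ (g * g) = 0) (hfg : f = g * h)
    (hf : f * f ∈ CoordLE (curve6 a 0 e) m) : ℓ (f * f) = 0 := by
  obtain ⟨μ, -, hμ⟩ := hm
  obtain ⟨p, hp, hpg, hpz⟩ := exists_lift rfl hg
  obtain ⟨q, hq, hqf, hqz⟩ :=
    exists_lift (show f * f = (g * g) * (h * h) by rw [hfg]; ring) hf
  have hC : ∀ᵐ z ∂μ.restrict (curve6 a 0 e), z ∈ curve6 a 0 e :=
    MeasureTheory.ae_restrict_mem (measurableSet_curve6 0)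
  -- The integral of g² ≥ 0 is 0, so g² vanishes almost everywhere on C, and with it f² = g²h².
  rw [← hpg, hℓ ⟨p, hp⟩, (hμ ⟨p, hp⟩).2, MeasureTheory.setIntegral_eq_zero_iff_of_nonneg_ae
    (by
      filter_upwards [hC] with z hz
      rw [hpz z hz, map_mul]
      exact mul_self_nonneg _) (hμ ⟨p, hp⟩).1] at hg0
  rw [← hqf, hℓ ⟨q, hq⟩, (hμ ⟨q, hq⟩).2]
  refine MeasureTheory.integral_eq_zero_of_ae ?_
  filter_upwards [hC, hg0] with z hz h0
  rw [hqz z hz, map_mul, ← hpz z hz]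
  exact mul_eq_zero_of_left h0 _

/-- If `y^(j - 2k) F(y)` is isotropic for `ℓ`, then some isotropic element of `V^(k)` has a
nonzero coefficient at `y^k`. -/
theorem exists_isotropic_notMem_spaceZ (he : e ≠ 0) {k : ℕ} (hk : 1 ≤ k)
    {ℓ : CoordRing (curve6 a 0 e) →ₗ[ℝ] ℝ} {j : ℕ} {F : Polynomial ℝ} (hF0 : F ≠ 0)
    (hF : F.natDegree ≤ 3 * k - 1)
    (hℓ : ∀ f h, f = ofPoly a e k (X ^ j * F) * h → f * f ∈ CoordLE (curve6 a 0 e) (2 * k) →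
      ℓ (f * f) = 0) :
    ∃ q ∈ spaceV a 0 e k, ℓ (q * q) = 0 ∧ q ∉ spaceZ a 0 e k := by
  -- F is padded with powers of X to degree exactly 3k − 1, so that XG has degree 3k, out of reach
  -- of Z.
  set G : Polynomial ℝ := X ^ (3 * k - 1 - F.natDegree) * F
  have hG : G.natDegree = 3 * k - 1 := by
    rw [Polynomial.natDegree_X_pow_mul _ hF0]
    omega
  have hGn : G.natDegree ≤ 3 * k - 1 := hG.le
  refine ⟨ofPoly a e k (X * G), ?_, hℓ _
    (yInv a e ^ j * y ^ (1 + (3 * k - 1 - F.natDegree))) ?_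
    (ofPoly_mul_mem_coordLE he hk hGn hGn), fun h => ?_⟩
  · rw [spaceV_eq he hk]
    exact mem_polySpace.2 ⟨G, hGn, by rw [pow_one]⟩
  · have h1 : (y * yInv a e) ^ j = 1 := by rw [y_mul_yInv he, one_pow]
    simp only [ofPoly_apply, G, map_mul, map_pow, Polynomial.aeval_X, pow_add, pow_one]
    linear_combination (-(yInv a e ^ (2 * k) * y * y ^ (3 * k - 1 - F.natDegree) *
      aeval y F)) * h1
  · obtain ⟨H, hH, hHG⟩ := mem_polySpace.1 (spaceZ_le_polySpace he hk h)
    rw [pow_one] at hHG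
    have := mul_left_cancel₀ Polynomial.X_ne_zero (ofPoly_injective he k hHG)
    rw [this, hG] at hH
    omega

/-- If a nonzero element `y^(1 - 2k) F(y)` of `V^(k)` is isotropic for `ℓ`, then some isotropic
element of `ℝ[C]_{≤ k}` has a nonzero coefficient at `x^k`. -/
theorem exists_isotropic_notMem_spaceU (he : e ≠ 0) {k : ℕ} (hk : 1 ≤ k)
    {ℓ : CoordRing (curve6 a 0 e) →ₗ[ℝ] ℝ} {F : Polynomial ℝ} (hF0 : F ≠ 0)
    (hF : F.natDegree ≤ 3 * k - 1)
    (hℓ : ∀ f h, f = ofPoly a e k (X ^ 1 * F) * h → f * f ∈ CoordLE (curve6 a 0 e) (2 * k) →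
      ℓ (f * f) = 0) :
    ∃ q ∈ CoordLE (curve6 a 0 e) k, ℓ (q * q) = 0 ∧ q ∉ spaceU a 0 e k := by
  obtain ⟨G, hFG, hG⟩ := Polynomial.exists_eq_pow_rootMultiplicity_mul_and_not_dvd F hF0 0
  rw [Polynomial.C_0, sub_zero] at hFG hG
  set j := F.rootMultiplicity 0
  have hG0 : G.coeff 0 ≠ 0 := fun h => hG (Polynomial.X_dvd_iff.2 h)
  have hGne : G ≠ 0 := by rintro rfl; simp at hG0
  have hGn : G.natDegree ≤ 3 * k - 1 := by
    rw [hFG, Polynomial.natDegree_X_pow_mul _ hGne] at hF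
    omega
  -- With all powers of X removed, G(0) ≠ 0. The linear T is solved for so that TG satisfies the
  -- coefficient relation of ℝ[C]_{≤ k}, with constant term e G(0)² ≠ 0.
  set T : Polynomial ℝ := C (e * G.coeff 0) - C (e * G.coeff 1 + k * a * G.coeff 0) * X
  have hT : T.natDegree ≤ 1 := by
    simp only [T]
    compute_degree
  have hTG0 : (T * G).coeff 0 = e * G.coeff 0 * G.coeff 0 := by
    rw [Polynomial.mul_coeff_zero]
    simp [T]
  have hTG1 : (T * G).coeff 1 = e * G.coeff 0 * G.coeff 1 -
      (e * G.coeff 1 + k * a * G.coeff 0) * G.coeff 0 := by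
    rw [Polynomial.mul_coeff_one]
    simp [T]
    ring
  have hmem : ofPoly a e k (T * G) ∈ CoordLE (curve6 a 0 e) k := by
    refine mem_coordLE_of_coeff he hk (Polynomial.natDegree_mul_le.trans (by omega)) ?_
    rw [hTG0, hTG1]
    ring
  refine ⟨_, hmem, hℓ _ (yInv a e ^ (1 + j) * aeval y T) ?_ (mul_mem_coordLE hmem hmem),
    fun h => ?_⟩
  · have h1 : (y * yInv a e) ^ (1 + j) = 1 := by rw [y_mul_yInv he, one_pow]
    rw [hFG]
    simp only [ofPoly_apply, map_mul, map_pow, Polynomial.aeval_X]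
    linear_combination (-(yInv a e ^ (2 * k) * aeval y T * aeval y G)) * h1
  · rw [spaceU_eq he hk] at h
    obtain ⟨H, -, hH⟩ := mem_polySpace.1 h
    rw [← ofPoly_injective he k hH] at hTG0
    simp [he, hG0] at hTG0

theorem monic_X_pow_sub_of_natDegree_lt {n : ℕ} {G : Polynomial ℝ} (hG : G.natDegree < n) :
    (X ^ n - G).Monic ∧ (X ^ n - G).natDegree = n := by
  have h : G.degree < (n : WithBot ℕ) := by
    rcases eq_or_ne G 0 with rfl | h0
    · simp
    · exact (Polynomial.natDegree_lt_iff_degree_lt h0).1 hG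
  refine ⟨Polynomial.monic_X_pow_sub h, ?_⟩
  rw [Polynomial.natDegree_sub_eq_left_of_natDegree_lt, Polynomial.natDegree_X_pow]
  rwa [Polynomial.natDegree_X_pow]

end CubicCurve

end CubicTMP

namespace CubicTMP

open Polynomial (X C)

/-! ### Singularity and the rank conditions -/

section Characterization

variable {a e : ℝ}

theorem finiteDimensional_coordLE (he : e ≠ 0) (k : ℕ) :
    FiniteDimensional ℝ (CoordLE (curve6 a 0 e) k) :=
  Submodule.finiteDimensional_of_le (S₂ := polySpace a e k 0 (3 * k))
    (coordLE_le fun i j hij => monomial_mem_polySpace he (by omega) (by omega) (by omega))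

theorem finiteDimensional_spaceV (he : e ≠ 0) {k : ℕ} (hk : 1 ≤ k) :
    FiniteDimensional ℝ (spaceV a 0 e k) := by
  rw [spaceV_eq he hk]
  infer_instance

theorem coordForm_isSymm {K : Set (Fin 2 → ℝ)} {k : ℕ} (ℓ : CoordLE K (2 * k) →ₗ[ℝ] ℝ) :
    (coordForm ℓ).IsSymm :=
  ⟨fun g h => congrArg ℓ (Subtype.ext (mul_comm g.1 h.1))⟩

theorem curveLocalForm_isSymm {d : ℝ} {k : ℕ} (hk : 1 ≤ k)
    (ℓ : CoordLE (curve6 a d e) (2 * k) →ₗ[ℝ] ℝ) : (curveLocalForm a d e hk ℓ).IsSymm :=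
  ⟨fun g h => congrArg ℓ (Subtype.ext (congrArg (1 * ·) (mul_comm g.1 h.1)))⟩

theorem coordForm_apply_of_extends {K : Set (Fin 2 → ℝ)} {k : ℕ} {ℓ : CoordLE K (2 * k) →ₗ[ℝ] ℝ}
    {Λ : CoordRing K →ₗ[ℝ] ℝ} (h : Λ.comp (CoordLE K (2 * k)).subtype = ℓ) (f g : CoordLE K k) :
    coordForm ℓ f g = Λ (f * g) :=
  (LinearMap.congr_fun h ⟨f.1 * g.1, mul_mem_coordLE f.2 g.2⟩).symm

theorem curveLocalForm_apply_of_extends {d : ℝ} {k : ℕ} (hk : 1 ≤ k)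
    {ℓ : CoordLE (curve6 a d e) (2 * k) →ₗ[ℝ] ℝ} {Λ : CoordRing (curve6 a d e) →ₗ[ℝ] ℝ}
    (h : Λ.comp (CoordLE (curve6 a d e) (2 * k)).subtype = ℓ) (f g : spaceV a d e k) :
    curveLocalForm a d e hk ℓ f g = Λ (f * g) := by
  rw [← one_mul ((f : CoordRing (curve6 a d e)) * g)]
  exact (LinearMap.congr_fun h
    ⟨1 * (f.1 * g.1), spaceV_mul_mem a d e hk f.1 f.2 g.1 g.2⟩).symm

theorem apply_toCoord_of_extends {K : Set (Fin 2 → ℝ)} {m : ℕ} {L : PolyLE m →ₗ[ℝ] ℝ}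
    {hL : Descends K L} {Λ : CoordRing K →ₗ[ℝ] ℝ}
    (h : Λ.comp (CoordLE K m).subtype = inducedFunctional K L hL) (p : PolyLE m) :
    Λ (toCoord K p.1) = L p := by
  rw [← inducedFunctional_apply K L hL p, ← h]
  rfl

/-- A singular functional has a nonzero isotropic element in `ℝ[C]_{≤ k}` or in `V^(k)`. -/
theorem exists_isotropic_of_not_isNonsingular {k : ℕ} (hk : 1 ≤ k) {L : PolyLE (2 * k) →ₗ[ℝ] ℝ}
    {hL : Descends (curve6 a 0 e) L} (hsing : ¬ IsNonsingular a 0 e hk L hL)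
    {Λ : CoordRing (curve6 a 0 e) →ₗ[ℝ] ℝ}
    (hΛ : Λ.comp (CoordLE (curve6 a 0 e) (2 * k)).subtype =
      inducedFunctional (curve6 a 0 e) L hL) :
    (∃ f ∈ CoordLE (curve6 a 0 e) k, f ≠ 0 ∧ Λ (f * f) = 0) ∨
      ∃ f ∈ spaceV a 0 e k, f ≠ 0 ∧ Λ (f * f) = 0 := by
  by_cases h : formKer (polyForm L) = idealLE (curve6 a 0 e) k
  · right
    have h2 : formKer (curveLocalForm a 0 e hk (inducedFunctional (curve6 a 0 e) L hL)) ≠ ⊥ :=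
      fun h2 => hsing ⟨h, h2⟩
    obtain ⟨f, hf, hf0⟩ := Submodule.exists_mem_ne_zero_of_ne_bot h2
    refine ⟨f.1, f.2, fun h0 => hf0 (Subtype.ext h0), ?_⟩
    rw [← curveLocalForm_apply_of_extends hk hΛ]
    exact LinearMap.congr_fun (LinearMap.mem_ker.1 hf) f
  · left
    have hle : idealLE (curve6 a 0 e) k ≤ formKer (polyForm L) := by
      intro p hp
      refine LinearMap.mem_ker.2 (LinearMap.ext fun q => ?_)
      exact hL ⟨q.1 * p.1, mul_mem_polyLE q.2 p.2⟩
        (Ideal.mul_mem_left (MvPolynomial.vanishingIdeal ℝ (curve6 a 0 e)) q.1 hp)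
    obtain ⟨p, hp, hpI⟩ := SetLike.exists_of_lt (lt_of_le_of_ne hle (Ne.symm h))
    refine ⟨toCoord _ p.1, ⟨p.1, p.2, rfl⟩, fun h0 => hpI (toCoord_eq_zero_iff.1 h0), ?_⟩
    rw [← map_mul, apply_toCoord_of_extends hΛ ⟨p.1 * p.1, mul_mem_polyLE p.2 p.2⟩]
    exact LinearMap.congr_fun (LinearMap.mem_ker.1 hp) p

/-- For a singular moment functional there are isotropic elements with a nonzero coefficient at
`x^k`, and at `y^k`. -/
theorem IsMomentFunctional.exists_isotropic (he : e ≠ 0) {k : ℕ} (hk : 1 ≤ k)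
    {L : PolyLE (2 * k) →ₗ[ℝ] ℝ} {hL : Descends (curve6 a 0 e) L}
    (hm : IsMomentFunctional (curve6 a 0 e) L) (hsing : ¬ IsNonsingular a 0 e hk L hL)
    {Λ : CoordRing (curve6 a 0 e) →ₗ[ℝ] ℝ}
    (hΛ : Λ.comp (CoordLE (curve6 a 0 e) (2 * k)).subtype =
      inducedFunctional (curve6 a 0 e) L hL) :
    (∃ q ∈ CoordLE (curve6 a 0 e) k, Λ (q * q) = 0 ∧ q ∉ spaceU a 0 e k) ∧
      ((∃ q ∈ CoordLE (curve6 a 0 e) k, Λ (q * q) = 0 ∧ q ∉ spaceW a 0 e k) ∨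
        ∃ q ∈ spaceV a 0 e k, Λ (q * q) = 0 ∧ q ∉ spaceZ a 0 e k) := by
  have hΛL := apply_toCoord_of_extends hΛ
  have hVcase : ∀ F : Polynomial ℝ, F ≠ 0 → F.natDegree ≤ 3 * k - 1 →
      Λ (ofPoly a e k (X ^ 1 * F) * ofPoly a e k (X ^ 1 * F)) = 0 →
      (∃ q ∈ CoordLE (curve6 a 0 e) k, Λ (q * q) = 0 ∧ q ∉ spaceU a 0 e k) ∧
        ∃ q ∈ spaceV a 0 e k, Λ (q * q) = 0 ∧ q ∉ spaceZ a 0 e k := by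
    intro F hF0 hF hΛF
    have hdiv : ∀ f h, f = ofPoly a e k (X ^ 1 * F) * h →
        f * f ∈ CoordLE (curve6 a 0 e) (2 * k) → Λ (f * f) = 0 := fun f h hfh hf =>
      hm.apply_sq_mul_eq_zero hΛL
        (by rw [pow_one]; exact ofPoly_mul_mem_coordLE he hk hF hF) hΛF hfh hf
    exact ⟨exists_isotropic_notMem_spaceU he hk hF0 hF hdiv,
      exists_isotropic_notMem_spaceZ he hk hF0 hF hdiv⟩
  rcases exists_isotropic_of_not_isNonsingular hk hsing hΛ with
    ⟨f, hf, hf0, hff⟩ | ⟨f, hf, hf0, hff⟩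
  · obtain ⟨F, hF, -, rfl⟩ := exists_of_mem_coordLE he hf
    have hF0 : F ≠ 0 := by rintro rfl; exact hf0 (map_zero _)
    -- If F(0) = 0 the element already lies in V^(k). Otherwise it lies outside U, and its degree
    -- decides: 3k puts it outside W, less leaves room to multiply it into V^(k) outside Z.
    by_cases hc : F.coeff 0 = 0
    · obtain ⟨G, rfl⟩ := Polynomial.X_dvd_iff.2 hc
      have hG0 : G ≠ 0 := right_ne_zero_of_mul hF0
      rw [Polynomial.natDegree_X_mul hG0] at hF
      obtain ⟨h1, h2⟩ := hVcase G hG0 (by omega) (by rwa [pow_one])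
      exact ⟨h1, Or.inr h2⟩
    · refine ⟨⟨_, hf, hff, fun h => ?_⟩, ?_⟩
      · rw [spaceU_eq he hk] at h
        obtain ⟨H, -, hH⟩ := mem_polySpace.1 h
        apply hc
        rw [← ofPoly_injective he k hH, Polynomial.mul_coeff_zero]
        simp
      · rcases eq_or_lt_of_le hF with hFk | hFk
        · refine Or.inl ⟨_, hf, hff, fun h => ?_⟩
          obtain ⟨H, hH, hHF⟩ := mem_polySpace.1 (spaceW_le_polySpace he hk h)
          rw [pow_zero, one_mul] at hHF
          rw [ofPoly_injective he k hHF] at hH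
          omega
        · exact Or.inr (exists_isotropic_notMem_spaceZ he hk (j := 0) hF0 (by omega)
            fun g h hgh hg => hm.apply_sq_mul_eq_zero hΛL (mul_mem_coordLE hf hf) hff
              (by rwa [pow_zero, one_mul] at hgh) hg)
  · rw [spaceV_eq he hk] at hf
    obtain ⟨F, hF, rfl⟩ := mem_polySpace.1 hf
    obtain ⟨h1, h2⟩ := hVcase F (by rintro rfl; simp at hf0) hF hff
    exact ⟨h1, Or.inr h2⟩

end Characterization

end CubicTMP

theorem theorem4p5 (k : ℕ) (hk : 1 ≤ k) (a e : ℝ)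
    (hirr : Irreducible (CubicTMP.P6 a 0 e))
    (L : CubicTMP.PolyLE (2 * k) →ₗ[ℝ] ℝ)
    (hL : CubicTMP.Descends (CubicTMP.curve6 a 0 e) L)
    (hsing : ¬ CubicTMP.IsNonsingular a 0 e hk L hL) :
    CubicTMP.IsMomentFunctional (CubicTMP.curve6 a 0 e) L ↔
      CubicTMP.SquarePositive
          (CubicTMP.coordForm (CubicTMP.inducedFunctional (CubicTMP.curve6 a 0 e) L hL)) ∧
        CubicTMP.SquarePositive
          (CubicTMP.curveLocalForm a 0 e hk
            (CubicTMP.inducedFunctional (CubicTMP.curve6 a 0 e) L hL)) ∧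
        CubicTMP.formRank
            (CubicTMP.coordForm (CubicTMP.inducedFunctional (CubicTMP.curve6 a 0 e) L hL)) =
          CubicTMP.formRank
            (CubicTMP.restrictForm
              (CubicTMP.coordForm (CubicTMP.inducedFunctional (CubicTMP.curve6 a 0 e) L hL))
              (CubicTMP.spaceU a 0 e k)) ∧
        (CubicTMP.formRank
              (CubicTMP.coordForm (CubicTMP.inducedFunctional (CubicTMP.curve6 a 0 e) L hL)) =
            CubicTMP.formRank
              (CubicTMP.restrictForm
                (CubicTMP.coordForm (CubicTMP.inducedFunctional (CubicTMP.curve6 a 0 e) L hL))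
                (CubicTMP.spaceW a 0 e k)) ∨
          CubicTMP.formRank
              (CubicTMP.curveLocalForm a 0 e hk
                (CubicTMP.inducedFunctional (CubicTMP.curve6 a 0 e) L hL)) =
            CubicTMP.formRank
              (CubicTMP.restrictForm
                (CubicTMP.curveLocalForm a 0 e hk
                  (CubicTMP.inducedFunctional (CubicTMP.curve6 a 0 e) L hL))
                (CubicTMP.spaceZ a 0 e k))) := by
  have he := CubicTMP.ne_zero_of_irreducible hirr
  obtain ⟨Λ, hΛ⟩ :=
    LinearMap.exists_extend (CubicTMP.inducedFunctional (CubicTMP.curve6 a 0 e) L hL)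
  have hΛL := CubicTMP.apply_toCoord_of_extends hΛ
  have hR := CubicTMP.coordForm_apply_of_extends hΛ
  have hV := CubicTMP.curveLocalForm_apply_of_extends hk hΛ
  have hRs := CubicTMP.coordForm_isSymm (CubicTMP.inducedFunctional (CubicTMP.curve6 a 0 e) L hL)
  have hVs := CubicTMP.curveLocalForm_isSymm hk
    (CubicTMP.inducedFunctional (CubicTMP.curve6 a 0 e) L hL)
  have := CubicTMP.finiteDimensional_coordLE (a := a) he k
  have := CubicTMP.finiteDimensional_spaceV (a := a) he hk
  have hVmul : ∀ g ∈ CubicTMP.spaceV a 0 e k,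
      g * g ∈ CubicTMP.CoordLE (CubicTMP.curve6 a 0 e) (2 * k) := fun g hg => by
    simpa using CubicTMP.spaceV_mul_mem a 0 e hk g hg g hg
  constructor
  · intro hm
    have hRp : CubicTMP.SquarePositive (CubicTMP.coordForm
        (CubicTMP.inducedFunctional (CubicTMP.curve6 a 0 e) L hL)) := fun g _ => by
      rw [hR]
      exact hm.apply_sq_nonneg hΛL _ (CubicTMP.mul_mem_coordLE g.2 g.2)
    have hVp : CubicTMP.SquarePositive (CubicTMP.curveLocalForm a 0 e hk
        (CubicTMP.inducedFunctional (CubicTMP.curve6 a 0 e) L hL)) := fun g _ => by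
      rw [hV]
      exact hm.apply_sq_nonneg hΛL _ (hVmul _ g.2)
    obtain ⟨⟨p, hp, hp0, hpU⟩, h⟩ := hm.exists_isotropic he hk hsing hΛ
    refine ⟨hRp, hVp, CubicTMP.formRank_eq_of_isotropic hRs hRp (CubicTMP.spaceU_le a 0 e k)
      (CubicTMP.coordLE_le_sup_x_pow he hk) (w := ⟨p, hp⟩) (by rw [hR]; exact hp0) hpU, ?_⟩
    refine h.imp ?_ ?_
    · rintro ⟨q, hq, hq0, hqW⟩
      exact CubicTMP.formRank_eq_of_isotropic hRs hRp (CubicTMP.spaceW_le a 0 e k)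
        (CubicTMP.coordLE_le_sup_y_pow he hk) (w := ⟨q, hq⟩) (by rw [hR]; exact hq0) hqW
    · rintro ⟨q, hq, hq0, hqZ⟩
      exact CubicTMP.formRank_eq_of_isotropic hVs hVp (CubicTMP.spaceZ_le a 0 e k)
        (CubicTMP.spaceV_le_sup_y_pow k) (w := ⟨q, hq⟩) (by rw [hV]; exact hq0) hqZ
  · rintro ⟨hRp, hVp, hU, h⟩
    have hRp' : ∀ g ∈ CubicTMP.CoordLE (CubicTMP.curve6 a 0 e) k, 0 ≤ Λ (g * g) := by
      intro g hg
      rcases eq_or_ne g 0 with rfl | hg0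
      · simp
      · rw [← hR ⟨g, hg⟩ ⟨g, hg⟩]
        exact hRp _ fun h0 => hg0 (congrArg Subtype.val h0)
    have hVp' : ∀ g ∈ CubicTMP.spaceV a 0 e k, 0 ≤ Λ (g * g) := by
      intro g hg
      rcases eq_or_ne g 0 with rfl | hg0
      · simp
      · rw [← hV ⟨g, hg⟩ ⟨g, hg⟩]
        exact hVp _ fun h0 => hg0 (congrArg Subtype.val h0)
    have hx : CubicTMP.xC a 0 e ^ k ∈ CubicTMP.CoordLE (CubicTMP.curve6 a 0 e) k :=
      CubicTMP.basisB_subset a 0 e k (Or.inl rfl)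
    have hy : CubicTMP.yC a 0 e ^ k ∈ CubicTMP.spaceU a 0 e k := by
      simpa using CubicTMP.monomial_mem_spaceU (a := a) he (k := k) (i := 0) (l := k) (by omega)
        (by omega)
    -- Here p = x^k − u with u in U, so its polynomial P has P(0) = e^k ≠ 0.
    obtain ⟨p, hp0, hpU⟩ := CubicTMP.exists_isotropic_of_formRank_eq hRs hRp hU ⟨_, hx⟩
    obtain ⟨P, hP, -, hPp⟩ := CubicTMP.exists_of_mem_coordLE he p.2
    rw [hR] at hp0
    have hP0 : P.coeff 0 ≠ 0 := by
      rw [CubicTMP.spaceU_eq he hk] at hpU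
      obtain ⟨G, -, hG⟩ := CubicTMP.mem_polySpace.1 hpU
      have hG' : CubicTMP.ofPoly a e k (Polynomial.X ^ 2 * G) = CubicTMP.xC a 0 e ^ k - p := hG
      rw [← hPp, CubicTMP.x_pow_eq he, ← map_sub] at hG'
      have h1 := congrArg (Polynomial.eval 0) (CubicTMP.ofPoly_injective he k hG')
      rw [Polynomial.coeff_zero_eq_eval_zero]
      intro h0
      simp [h0, he, eq_comm] at h1
    obtain ⟨Q, hQ, hQn, hQR, hQi⟩ : ∃ Q : Polynomial ℝ, Q.Monic ∧ Q.natDegree = 3 * k ∧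
        CubicTMP.ofPoly a e k Q * CubicTMP.ofPoly a e k Q ∈
          CubicTMP.CoordLE (CubicTMP.curve6 a 0 e) (2 * k) ∧
        Λ (CubicTMP.ofPoly a e k Q * CubicTMP.ofPoly a e k Q) = 0 := by
      -- y^k corresponds to X^(3k), so subtracting an element of W or Z leaves a monic polynomial of
      -- degree 3k; (a) and (b) serve only to supply it.
      have hrep : ∀ q : CubicTMP.CoordRing (CubicTMP.curve6 a 0 e), ∀ j n, j + n < 3 * k →
          CubicTMP.yC a 0 e ^ k - q ∈ CubicTMP.polySpace a e k j n →
          ∃ Q : Polynomial ℝ, Q.Monic ∧ Q.natDegree = 3 * k ∧ CubicTMP.ofPoly a e k Q = q := by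
        intro q j n hjn hq
        obtain ⟨G, hG, hGq⟩ := CubicTMP.mem_polySpace.1 hq
        have hdeg : (Polynomial.X ^ j * G).natDegree < 3 * k := by
          refine Polynomial.natDegree_mul_le.trans_lt ?_
          rw [Polynomial.natDegree_X_pow]
          omega
        obtain ⟨h1, h2⟩ := CubicTMP.monic_X_pow_sub_of_natDegree_lt hdeg
        refine ⟨_, h1, h2, ?_⟩
        rw [map_sub, hGq, show 3 * k = 2 * k + k by ring, ← CubicTMP.y_pow_eq he, sub_sub_cancel]
      rcases h with h | h
      · obtain ⟨q, hq0, hqW⟩ := CubicTMP.exists_isotropic_of_formRank_eq hRs hRp h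
          ⟨_, CubicTMP.spaceU_le a 0 e k hy⟩
        obtain ⟨Q, hQ, hQn, hQq⟩ :=
          hrep q 0 (3 * k - 1) (by omega) (CubicTMP.spaceW_le_polySpace he hk hqW)
        rw [hR] at hq0
        exact ⟨Q, hQ, hQn, by rw [hQq]; exact CubicTMP.mul_mem_coordLE q.2 q.2, by rw [hQq, hq0]⟩
      · obtain ⟨q, hq0, hqZ⟩ := CubicTMP.exists_isotropic_of_formRank_eq hVs hVp h
          ⟨_, CubicTMP.spaceU_le_spaceV k hy⟩
        obtain ⟨Q, hQ, hQn, hQq⟩ :=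
          hrep q 1 (3 * k - 2) (by omega) (CubicTMP.spaceZ_le_polySpace he hk hqZ)
        rw [hV] at hq0
        exact ⟨Q, hQ, hQn, by rw [hQq]; exact hVmul _ q.2, by rw [hQq, hq0]⟩
    obtain ⟨S, w, hS, hw, hatom⟩ := CubicTMP.exists_atomic_on_curve he hk Λ hRp' hVp' hP hP0
      (by rw [hPp]; exact p.2) (by rw [hPp, hp0]) hQ hQn hQR hQi
    exact CubicTMP.isMomentFunctional_of_atomic hS hw fun q => by rw [← hΛL, hatom q.1 q.2]
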